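/- All spaces are over $\mathbb C$. For a Banach space $X$ let $B(X)$ be the algebra of bounded linear operators on $X$, let $X'$ be the dual space of $X$, and for $A\in B(X)$ let $A'\in B(X')$ be the Banach space adjoint, $A'f=f\circ A$. A standard operator algebra on $X$ is a (not necessarily unital, not necessarily closed) subalgebra of $B(X)$ that contains all bounded linear operators of finite rank. Let $X,Y$ be complex Banach spaces with $\dim X>1$, let $\mathcal A\subset B(X)$ and $\mathcal B\subset B(Y)$ be standard operator algebras, and let $\phi:\mathcal A\to\mathcal B$ be a bijective map (not assumed to be additive) such that \[ \phi\big(\tfrac12(AB+BA)\big)=\tfrac12\big(\phi(A)\phi(B)+\phi(B)\phi(A)\big)\qquad(A,B\in\mathcal A). \] Then $\phi$ is additive. Moreover: If $X$ is infinite dimensional, then at least one of the following holds: (i) there is an invertible bounded linear operator $T:X\to Y$ such that $\phi(A)=TAT^{-1}$ for all $A\in\mathcal A$; (ii) there is an invertible bounded conjugate-linear operator $T:X\to Y$ such that $\phi(A)=TAT^{-1}$ for all $A\in\mathcal A$; (iii) there is an invertible bounded linear operator $T:X'\to Y$ such that $\phi(A)=TA'T^{-1}$ for all $A\in\mathcal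 A$; (iv) there is an invertible bounded conjugate-linear operator $T:X'\to Y$ such that $\phi(A)=TA'T^{-1}$ for all $A\in\mathcal A$. If $X$ is finite dimensional, then $Y$ is finite dimensional, $\dim X=\dim Y=:n$, $\mathcal A=B(X)$ and $\mathcal B=B(Y)$. Identify $\mathcal A$ and $\mathcal B$ with the matrix algebra $M_n(\mathbb C)$ by means of any bases of $X$ and of $Y$. Then at least one of the following holds: (v) there are a ring automorphism $h$ of $\mathbb C$ and an invertible matrix $T\in M_n(\mathbb C)$ such that $\phi(A)=Th(A)T^{-1}$ for all $A\in M_n(\mathbb C)$; (vi) there are a ring automorphism $h$ of $\mathbb C$ and an invertible matrix $T\in M_n(\mathbb C)$ such that $\phi(A)=Th(A)^tT^{-1}$ for all $A\in M_n(\mathbb C)$. Here ${}^t$ is the transpose, and $h(A)$ is the matrix obtained from $A$ by applying $h$ to every entry. -/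

import Mathlib

open scoped Matrix

/-- A (not necessarily unital, not necessarily closed) subalgebra of `B(X)` is a standard operator
algebra if it contains every bounded linear operator of finite rank. -/
def IsStandardOperatorAlgebra {X : Type*} [NormedAddCommGroup X] [NormedSpace ℂ X]
    (𝒜 : NonUnitalSubalgebra ℂ (X →L[ℂ] X)) : Prop :=
  ∀ F : X →L[ℂ] X, FiniteDimensional ℂ (LinearMap.range (F : X →ₗ[ℂ] X)) → F ∈ 𝒜

/-- The Banach space adjoint `A' : X' → X'`, `f ↦ f ∘ A`, of a bounded operator `A` on `X`. -/
noncomputable def banachAdjoint {X : Type*} [NormedAddCommGroup X] [NormedSpace ℂ X]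
    (A : X →L[ℂ] X) : StrongDual ℂ X →L[ℂ] StrongDual ℂ X :=
  ContinuousLinearMap.precomp ℂ A

theorem banachAdjoint_apply {X : Type*} [NormedAddCommGroup X] [NormedSpace ℂ X]
    (A : X →L[ℂ] X) (f : StrongDual ℂ X) (x : X) : banachAdjoint A f x = f (A x) := rfl

/-! Additivity comes from the Peirce decomposition for a rank one idempotent `p`. Choose `s` with `φ
s = φ x + φ y`. Whenever `φ` is already known to be additive on `x ∘ t` and `y ∘ t`, injectivity
gives `s ∘ t = (x + y) ∘ t` (`addOn_of_annihilator`). With enough test elements `t` the error `s -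
(x + y)` must vanish. Pairs from different Peirce spaces are settled mostly by tests that kill one
summand. Pairs inside `p R (1 - p)` or `(1 - p) R p` need the identity for `(p + b) ∘ (t + c)`, and
the two diagonal spaces reduce to `p R (1 - p)`.

An additive Jordan map onto a prime algebra is multiplicative or antimultiplicative
(`jordan_hom_or_antihom`), so `φ` is a ring isomorphism from the algebra or its opposite. Such a map
sends `p` to a rank one idempotent `P`. Evaluating the images of the operators `f₀ ⊗ x` (or `f ⊗ x₀`
in the opposite case) at a vector fixed by `P` gives a bijection `T` from `X` (or `X'`) onto `Y`,
semilinear over a field automorphism `h` of `ℂ` (`exists_semilinear_of_ringEquiv`).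

In infinite dimension a gliding hump along a biorthogonal sequence makes `h⁻¹` continuous, so `h` is
the identity or conjugation, and the closed graph theorem bounds `T`. In finite dimension `h` stays
arbitrary; reading `T` in bases gives the matrix forms, with the dual basis producing the transpose.
-/

/-! ### Additivity by Peirce decomposition -/

section Additivity

set_option linter.unusedSectionVars false

variable {R S : Type*} [NonUnitalRing R] [Module ℂ R] [IsScalarTower ℂ R R] [SMulCommClass ℂ R R]
  [NonUnitalRing S] [Module ℂ S] [IsScalarTower ℂ S S] [SMulCommClass ℂ S S]

/-- The Jordan product `(x y + y x) / 2`. -/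
noncomputable def jordanMul {R : Type*} [NonUnitalRing R] [Module ℂ R] (x y : R) : R :=
  (1 / 2 : ℂ) • (x * y + y * x)

theorem jordanMul_add (x y z : R) : jordanMul x (y + z) = jordanMul x y + jordanMul x z := by
  simp only [jordanMul, mul_add, add_mul, ← smul_add]
  congr 1; abel

theorem jordanMul_comm (x y : R) : jordanMul x y = jordanMul y x := by
  simp only [jordanMul, add_comm]

theorem add_jordanMul (x y z : R) : jordanMul (x + y) z = jordanMul x z + jordanMul y z := by
  rw [jordanMul_comm, jordanMul_add, jordanMul_comm z, jordanMul_comm z]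

theorem sub_jordanMul (x y z : R) : jordanMul (x - y) z = jordanMul x z - jordanMul y z := by
  rw [eq_sub_iff_add_eq, ← add_jordanMul, sub_add_cancel]

theorem zero_jordanMul (z : R) : jordanMul 0 z = 0 := by simp [jordanMul]

theorem jordanMul_eq_zero_iff {x y : R} : jordanMul x y = 0 ↔ x * y + y * x = 0 := by
  rw [jordanMul, smul_eq_zero_iff_right (by norm_num)]

/-- `p` is an idempotent whose Peirce spaces act faithfully on each other. -/
structure IsPeirceFaithful {R : Type*} [NonUnitalRing R] (p : R) : Prop where
  idem : p * p = p
  -- With `1 - p` formal: `p * t = t`, `t * p = 0` says `t ∈ p R (1 - p)`, the "left" space; the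
  -- mirrored conditions give the "right" space `(1 - p) R p`. The "corner" is `p R p` and the
  -- "cocorner" `(1 - p) R (1 - p)`.
  eq_corner : ∀ z, (∀ t, p * t = 0 → t * p = 0 → z * t + t * z = 0) → p * z = z ∧ z * p = z
  left : ∀ z, p * z = 0 → (∀ t, p * t = t → t * p = 0 → t * z = 0) → z = 0
  right : ∀ z, z * p = 0 → (∀ t, p * t = 0 → t * p = t → z * t = 0) → z = 0
  corner_left : ∀ z, z * p = z → (∀ t, p * t = t → t * p = 0 → z * t = 0) → z = 0
  corner_right : ∀ z, p * z = z → (∀ t, p * t = 0 → t * p = t → t * z = 0) → z = 0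

/-- `φ` is additive on the pair `x, y`. -/
def AddOn (φ : R → S) (x y : R) : Prop := φ (x + y) = φ x + φ y

variable {φ : R → S}

theorem AddOn.symm {x y : R} (h : AddOn φ x y) : AddOn φ y x := by
  unfold AddOn at *; rw [add_comm, h, add_comm]

theorem jordan_map_zero (hs : Function.Surjective φ)
    (hJ : ∀ x y, φ (jordanMul x y) = jordanMul (φ x) (φ y)) : φ 0 = 0 := by
  obtain ⟨a, ha⟩ := hs 0
  rw [← zero_jordanMul a, hJ, ha, jordanMul_comm, zero_jordanMul]

theorem addOn_zero_left (h0 : φ 0 = 0) (y : R) : AddOn φ 0 y := by simp [AddOn, h0]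

theorem addOn_zero_right (h0 : φ 0 = 0) (y : R) : AddOn φ y 0 := by simp [AddOn, h0]

/-- Here `z` is the error `s - (x + y)`, where `φ s = φ x + φ y`. Two-step tests are included
because one product cannot always isolate a single Peirce component. -/
theorem addOn_of_annihilator (hφ : Function.Bijective φ)
    (hJ : ∀ x y, φ (jordanMul x y) = jordanMul (φ x) (φ y)) {x y : R}
    (H : ∀ z, (∀ t, AddOn φ (jordanMul x t) (jordanMul y t) → jordanMul z t = 0) →
      (∀ t t', AddOn φ (jordanMul (jordanMul x t) t') (jordanMul (jordanMul y t) t') →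
        jordanMul (jordanMul z t) t' = 0) → z = 0) : AddOn φ x y := by
  obtain ⟨s, hs⟩ := hφ.2 (φ x + φ y)
  have h1 : ∀ t, φ (jordanMul s t) = φ (jordanMul x t) + φ (jordanMul y t) := fun t => by
    rw [hJ, hs, add_jordanMul, hJ, hJ]
  have : s - (x + y) = 0 := by
    refine H _ (fun t ht => ?_) (fun t t' ht => ?_)
    · rw [sub_jordanMul, sub_eq_zero]
      apply hφ.1
      rw [add_jordanMul, ht, h1]
    · rw [sub_jordanMul, sub_jordanMul, sub_eq_zero]
      apply hφ.1
      rw [add_jordanMul, add_jordanMul, ht, hJ, h1, add_jordanMul, ← hJ, ← hJ]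
  rw [AddOn, ← hs, sub_eq_zero.1 this]

theorem mul_eq_zero_of_mul_right {p x y : R} (hx : x * p = 0) (hy : p * y = y) : x * y = 0 := by
  rw [← hy, ← mul_assoc, hx, zero_mul]

theorem mul_eq_zero_of_mul_left {p x y : R} (hx : x * p = x) (hy : p * y = 0) : x * y = 0 := by
  rw [← hx, mul_assoc, hy, mul_zero]

variable {p : R}

namespace IsPeirceFaithful

theorem eq_zero_of_right (hp : IsPeirceFaithful p) {z : R} (h1 : p * z = 0 ∨ z * p = 0)
    (h : ∀ t, p * t = 0 → t * p = 0 → jordanMul z t = 0) : z = 0 := by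
  have := hp.eq_corner z fun t h1 h2 => jordanMul_eq_zero_iff.1 (h t h1 h2)
  rcases h1 with h1 | h1
  · rw [← this.1, h1]
  · rw [← this.2, h1]

/-- Multiplying `z p + p z = 0` by `p` on either side gives `p z = z p`, and then `2 p z = 0`. -/
theorem mul_eq_zero_of_jordan (hp : IsPeirceFaithful p) {z : R} (h : jordanMul z p = 0) :
    p * z = 0 ∧ z * p = 0 := by
  have h1 := jordanMul_eq_zero_iff.1 h
  have h2 : p * z * p = - (z * p) := by
    rw [eq_neg_iff_add_eq_zero, add_comm]
    calc z * p + p * z * p = (z * p + p * z) * p := by rw [add_mul, mul_assoc z, hp.idem]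
      _ = 0 := by rw [h1, zero_mul]
  have h3 : p * z * p = - (p * z) := by
    rw [eq_neg_iff_add_eq_zero]
    calc p * z * p + p * z = p * (z * p + p * z) := by
          rw [mul_add, ← mul_assoc, ← mul_assoc, hp.idem]
      _ = 0 := by rw [h1, mul_zero]
  have h4 : p * z = z * p := by rw [← neg_inj, ← h3, h2]
  rw [← h4] at h1 ⊢
  have : (2 : ℂ) • (p * z) = 0 := by rw [two_smul, h1]
  simpa using this

end IsPeirceFaithful

section Pairs

variable (hφ : Function.Bijective φ) (hJ : ∀ x y, φ (jordanMul x y) = jordanMul (φ x) (φ y))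
  (hp : IsPeirceFaithful p)

include hφ hJ hp

/-- Cocorner tests kill `a` and force the error into the corner; tests from `p R (1 - p)` kill `b`
and then kill the error. The next three lemmas follow the same pattern, with `p` itself as first
test when the first summand is in the cocorner. -/
theorem addOn_corner_left {a b : R} (ha : p * a = a) (ha' : a * p = a) (hb : p * b = b)
    (hb' : b * p = 0) : AddOn φ a b := by
  have h0 := jordan_map_zero hφ.2 hJ
  refine addOn_of_annihilator hφ hJ fun z h _ => ?_
  have hz := hp.eq_corner z fun t h1 h2 => by
    rw [← jordanMul_eq_zero_iff]
    apply h
    rw [jordanMul_eq_zero_iff.2]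
    · exact addOn_zero_left h0 _
    · rw [mul_eq_zero_of_mul_left ha' h1, mul_eq_zero_of_mul_right h2 ha, add_zero]
  refine hp.corner_left z hz.2 fun t h1 h2 => ?_
  have : jordanMul z t = 0 := by
    apply h
    rw [jordanMul_eq_zero_iff (x := b).2]
    · exact addOn_zero_right h0 _
    · rw [mul_eq_zero_of_mul_right hb' h1, mul_eq_zero_of_mul_right h2 hb, add_zero]
  rw [jordanMul_eq_zero_iff, mul_eq_zero_of_mul_right h2 hz.1, add_zero] at this
  exact this

theorem addOn_corner_right {a c : R} (ha : p * a = a) (ha' : a * p = a) (hc : p * c = 0)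
    (hc' : c * p = c) : AddOn φ a c := by
  have h0 := jordan_map_zero hφ.2 hJ
  refine addOn_of_annihilator hφ hJ fun z h _ => ?_
  have hz := hp.eq_corner z fun t h1 h2 => by
    rw [← jordanMul_eq_zero_iff]
    apply h
    rw [jordanMul_eq_zero_iff.2]
    · exact addOn_zero_left h0 _
    · rw [mul_eq_zero_of_mul_left ha' h1, mul_eq_zero_of_mul_right h2 ha, add_zero]
  refine hp.corner_right z hz.1 fun t h1 h2 => ?_
  have : jordanMul z t = 0 := by
    apply h
    rw [jordanMul_eq_zero_iff (x := c).2]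
    · exact addOn_zero_right h0 _
    · rw [mul_eq_zero_of_mul_left hc' h1, mul_eq_zero_of_mul_left h2 hc, add_zero]
  rw [jordanMul_eq_zero_iff, mul_eq_zero_of_mul_left hz.2 h1, zero_add] at this
  exact this

theorem addOn_cocorner_left {d b : R} (hd : p * d = 0) (hd' : d * p = 0) (hb : p * b = b)
    (hb' : b * p = 0) : AddOn φ d b := by
  have h0 := jordan_map_zero hφ.2 hJ
  refine addOn_of_annihilator hφ hJ fun z h _ => ?_
  have hz := hp.mul_eq_zero_of_jordan (z := z) <| by
    apply h
    rw [jordanMul_eq_zero_iff.2]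
    · exact addOn_zero_left h0 _
    · rw [hd, hd', add_zero]
  refine hp.left z hz.1 fun t h1 h2 => ?_
  have : jordanMul z t = 0 := by
    apply h
    rw [jordanMul_eq_zero_iff (x := b).2]
    · exact addOn_zero_right h0 _
    · rw [mul_eq_zero_of_mul_right hb' h1, mul_eq_zero_of_mul_right h2 hb, add_zero]
  rw [jordanMul_eq_zero_iff, mul_eq_zero_of_mul_right hz.2 h1, zero_add] at this
  exact this

theorem addOn_cocorner_right {d c : R} (hd : p * d = 0) (hd' : d * p = 0) (hc : p * c = 0)
    (hc' : c * p = c) : AddOn φ d c := by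
  have h0 := jordan_map_zero hφ.2 hJ
  refine addOn_of_annihilator hφ hJ fun z h _ => ?_
  have hz := hp.mul_eq_zero_of_jordan (z := z) <| by
    apply h
    rw [jordanMul_eq_zero_iff.2]
    · exact addOn_zero_left h0 _
    · rw [hd, hd', add_zero]
  refine hp.right z hz.2 fun t h1 h2 => ?_
  have : jordanMul z t = 0 := by
    apply h
    rw [jordanMul_eq_zero_iff (x := c).2]
    · exact addOn_zero_right h0 _
    · rw [mul_eq_zero_of_mul_left hc' h1, mul_eq_zero_of_mul_left h2 hc, add_zero]
  rw [jordanMul_eq_zero_iff, mul_eq_zero_of_mul_left h2 hz.1, add_zero] at this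
  exact this

/-- One-step tests remove only the off-diagonal parts of the error. The two-step test by `p` and
then `t` removes `p z p`, after which the one-step tests reach the remaining cocorner part. -/
theorem addOn_left_right {b c : R} (hb : p * b = b)
    (hb' : b * p = 0) (hc : p * c = 0) (hc' : c * p = c) : AddOn φ b c := by
  have h0 := jordan_map_zero hφ.2 hJ
  refine addOn_of_annihilator hφ hJ fun z h h' => ?_
  have e1 : ∀ t, p * t = t → t * p = 0 → jordanMul b t = 0 := fun t h1 h2 => by
    rw [jordanMul_eq_zero_iff, mul_eq_zero_of_mul_right hb' h1, mul_eq_zero_of_mul_right h2 hb,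
      add_zero]
  have e2 : ∀ t, p * t = 0 → t * p = t → jordanMul c t = 0 := fun t h1 h2 => by
    rw [jordanMul_eq_zero_iff, mul_eq_zero_of_mul_left hc' h1, mul_eq_zero_of_mul_left h2 hc,
      add_zero]
  have hz1 : ∀ t, p * t = t → t * p = 0 → z * t + t * z = 0 := fun t h1 h2 => by
    rw [← jordanMul_eq_zero_iff]
    apply h
    rw [e1 t h1 h2]
    exact addOn_zero_left h0 _
  have hz2 : ∀ t, p * t = 0 → t * p = t → z * t + t * z = 0 := fun t h1 h2 => by
    rw [← jordanMul_eq_zero_iff]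
    apply h
    rw [e2 t h1 h2]
    exact addOn_zero_right h0 _
  have hpb : jordanMul b p = (1 / 2 : ℂ) • b := by rw [jordanMul, hb, hb', zero_add]
  have hpc : jordanMul c p = (1 / 2 : ℂ) • c := by rw [jordanMul, hc, hc', add_zero]
  have hz3 : ∀ t, p * t = t → t * p = 0 → jordanMul (jordanMul z p) t = 0 := fun t h1 h2 => by
    apply h'
    have : jordanMul (jordanMul b p) t = 0 := by
      rw [jordanMul_eq_zero_iff, hpb, smul_mul_assoc, mul_smul_comm, ← smul_add,
        jordanMul_eq_zero_iff.1 (e1 t h1 h2), smul_zero]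
    rw [this]
    exact addOn_zero_left h0 _
  -- the component in `(1 - p) R p`
  have k1 : z * p - p * z * p = 0 := by
    refine hp.left _ (by simp only [mul_sub, ← mul_assoc, hp.idem, sub_self]) fun t h1 h2 => ?_
    have := congrArg (· * p) (hz1 t h1 h2)
    simp only [add_mul, zero_mul, mul_assoc, h2, mul_zero, zero_add] at this
    simp only [mul_sub, ← mul_assoc, h2, zero_mul, sub_zero]
    rw [mul_assoc, this]
  have k2 : p * z - p * z * p = 0 := by
    refine hp.right _ (by simp only [sub_mul, mul_assoc, hp.idem, sub_self]) fun t h1 h2 => ?_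
    have := congrArg (p * ·) (hz2 t h1 h2)
    simp only [mul_add, ← mul_assoc, h1, zero_mul, add_zero, mul_zero] at this
    simp only [sub_mul, mul_assoc, h1, mul_zero, sub_zero]
    rw [← mul_assoc, this]
  rw [sub_eq_zero] at k1 k2
  have k3 : jordanMul z p = p * z * p := by
    rw [jordanMul, show z * p + p * z = p * z * p + p * z * p from congrArg₂ (· + ·) k1 k2,
      ← two_smul ℂ, smul_smul]
    norm_num
  have k4 : p * z * p = 0 := by
    refine hp.corner_left _ (by simp only [mul_assoc, hp.idem]) fun t h1 h2 => ?_
    have := hz3 t h1 h2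
    rw [k3, jordanMul_eq_zero_iff] at this
    simpa only [← mul_assoc, h2, zero_mul, add_zero] using this
  refine hp.left z (k2.trans k4) fun t h1 h2 => ?_
  have := hz1 t h1 h2
  rwa [mul_eq_zero_of_mul_right (k1.trans k4) h1, zero_add] at this

/-- Testing by `t ∈ p R (1 - p)` and then by `p` sends `a` to a multiple of `a t` and `b + c` to a
multiple of `t c`, which is the situation of `addOn_corner_left`. -/
theorem addOn_corner_offdiag {a b c : R} (ha : p * a = a) (ha' : a * p = a) (hb : p * b = b)
    (hb' : b * p = 0) (hc : p * c = 0) (hc' : c * p = c) : AddOn φ a (b + c) := by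
  have h0 := jordan_map_zero hφ.2 hJ
  refine addOn_of_annihilator hφ hJ fun z h h' => ?_
  have hz := hp.eq_corner z fun t h1 h2 => by
    rw [← jordanMul_eq_zero_iff]
    apply h
    rw [jordanMul_eq_zero_iff.2]
    · exact addOn_zero_left h0 _
    · rw [mul_eq_zero_of_mul_left ha' h1, mul_eq_zero_of_mul_right h2 ha, add_zero]
  refine hp.corner_left z hz.2 fun t h1 h2 => ?_
  have key : ∀ x, p * x = x → x * p = x →
      jordanMul (jordanMul x t) p = (1 / 2 : ℂ) • (1 / 2 : ℂ) • (x * t) := fun x hx hx' => by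
    rw [jordanMul, jordanMul, mul_eq_zero_of_mul_right h2 hx, add_zero, smul_mul_assoc,
      mul_smul_comm, mul_assoc, h2, mul_zero, smul_zero, zero_add, ← mul_assoc, hx]
  have : jordanMul (jordanMul z t) p = 0 := by
    apply h'
    have e : jordanMul (jordanMul (b + c) t) p = (1 / 2 : ℂ) • (t * c) := by
      rw [add_jordanMul, jordanMul_eq_zero_iff (x := b).2, zero_add, jordanMul, jordanMul,
        smul_mul_assoc, mul_smul_comm, add_mul, mul_add, ← mul_assoc, ← mul_assoc, h1, hc,
        mul_assoc, mul_assoc, h2, hc', mul_zero, zero_mul, zero_add, ← two_smul ℂ,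
        smul_smul, smul_smul]
      · norm_num
      · rw [mul_eq_zero_of_mul_right hb' h1, mul_eq_zero_of_mul_right h2 hb, add_zero]
    rw [e, key a ha ha']
    refine (addOn_corner_left hφ hJ hp ?_ ?_ ?_ ?_).symm
    · rw [mul_smul_comm, ← mul_assoc, h1]
    · rw [smul_mul_assoc, mul_assoc, hc']
    · rw [mul_smul_comm, mul_smul_comm, ← mul_assoc, ha]
    · rw [smul_mul_assoc, smul_mul_assoc, mul_assoc, h2, mul_zero, smul_zero, smul_zero]
  rw [key z hz.1 hz.2] at this
  simpa using this

theorem addOn_cocorner_offdiag {d b c : R} (hd : p * d = 0) (hd' : d * p = 0) (hb : p * b = b)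
    (hb' : b * p = 0) (hc : p * c = 0) (hc' : c * p = c) : AddOn φ d (b + c) := by
  have h0 := jordan_map_zero hφ.2 hJ
  refine addOn_of_annihilator hφ hJ fun z h h' => ?_
  have hz := hp.mul_eq_zero_of_jordan (z := z) <| by
    apply h
    rw [jordanMul_eq_zero_iff.2]
    · exact addOn_zero_left h0 _
    · rw [hd, hd', add_zero]
  refine hp.left z hz.1 fun t h1 h2 => ?_
  -- A second test `u` from the cocorner turns `d` into a multiple of `t d u` in `p R (1 - p)` and
  -- `b + c` into a cocorner element, so `addOn_cocorner_left` applies.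
  refine hp.eq_zero_of_right (Or.inr (by rw [mul_assoc, hz.2, mul_zero])) fun u hu hu' => ?_
  have key : ∀ x, p * x = 0 → x * p = 0 →
      jordanMul (jordanMul x t) u = (1 / 2 : ℂ) • (1 / 2 : ℂ) • (t * x * u) := fun x hx hx' => by
    rw [jordanMul, jordanMul, mul_eq_zero_of_mul_right hx' h1, zero_add, smul_mul_assoc,
      mul_smul_comm, ← mul_assoc, mul_eq_zero_of_mul_right hu' h1, zero_mul, smul_zero, add_zero]
  have : jordanMul (jordanMul z t) u = 0 := by
    apply h'
    have e : jordanMul (jordanMul (b + c) t) u =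
        (1 / 2 : ℂ) • (1 / 2 : ℂ) • (c * t * u + u * c * t) := by
      rw [add_jordanMul, jordanMul_eq_zero_iff (x := b).2, zero_add, jordanMul, jordanMul,
        smul_mul_assoc, mul_smul_comm, ← smul_add, add_mul, mul_add, ← mul_assoc, ← mul_assoc,
        mul_eq_zero_of_mul_right hu' h1, zero_mul, add_zero, mul_assoc t,
        mul_eq_zero_of_mul_left hc' hu, mul_zero, add_zero]
      rw [mul_eq_zero_of_mul_right hb' h1, mul_eq_zero_of_mul_right h2 hb, add_zero]
    rw [e, key d hd hd']
    refine (addOn_cocorner_left hφ hJ hp ?_ ?_ ?_ ?_).symm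
    · simp only [mul_smul_comm, mul_add, ← mul_assoc, hc, hu, zero_mul, add_zero, smul_zero]
    · simp only [smul_mul_assoc, add_mul, mul_assoc, h2, hu', mul_zero, add_zero, smul_zero]
    · simp only [mul_smul_comm, ← mul_assoc, h1]
    · simp only [smul_mul_assoc, mul_assoc, hu', mul_zero, smul_zero]
  rw [key z hz.1 hz.2] at this
  rw [jordanMul_eq_zero_iff, ← mul_assoc u, mul_eq_zero_of_mul_right hu' h1, zero_mul, add_zero]
  simpa using this

theorem addOn_peirce {a b c d : R} (ha : p * a = a) (ha' : a * p = a) (hb : p * b = b)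
    (hc' : c * p = c) (hd : p * d = 0) (hd' : d * p = 0) :
    AddOn φ (a + (b + c)) d := by
  have h0 := jordan_map_zero hφ.2 hJ
  refine addOn_of_annihilator hφ hJ fun z h h' => ?_
  have hz := hp.mul_eq_zero_of_jordan (z := z) <| by
    apply h
    rw [jordanMul_eq_zero_iff (x := d).2]
    · exact addOn_zero_right h0 _
    · rw [hd, hd', add_zero]
  refine hp.eq_zero_of_right (Or.inl hz.1) fun t h1 h2 => ?_
  apply h
  have : jordanMul (a + (b + c)) t = (1 / 2 : ℂ) • (b * t) + (1 / 2 : ℂ) • (t * c) := by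
    rw [add_jordanMul, add_jordanMul, jordanMul_eq_zero_iff (x := a).2, zero_add, jordanMul,
      jordanMul, mul_eq_zero_of_mul_right h2 hb, mul_eq_zero_of_mul_left hc' h1, add_zero, zero_add]
    rw [mul_eq_zero_of_mul_left ha' h1, mul_eq_zero_of_mul_right h2 ha, add_zero]
  rw [this]
  refine (addOn_cocorner_offdiag hφ hJ hp ?_ ?_ ?_ ?_ ?_ ?_).symm
  · simp only [jordanMul, mul_smul_comm, mul_add, ← mul_assoc, hd, h1, zero_mul, add_zero,
      smul_zero]
  · simp only [jordanMul, smul_mul_assoc, add_mul, mul_assoc, hd', h2, mul_zero, add_zero,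
      smul_zero]
  · simp only [mul_smul_comm, ← mul_assoc, hb]
  · simp only [smul_mul_assoc, mul_assoc, h2, mul_zero, smul_zero]
  · simp only [mul_smul_comm, ← mul_assoc, h1, zero_mul, smul_zero]
  · simp only [smul_mul_assoc, mul_assoc, hc']

/-- For cocorner `t`, `(p + b) ∘ (t + c) = (b t + c) / 2`, while `φ` is already additive on `p + b`
and on `t + c`. Expanding the product of the images therefore splits `φ` of the right-hand side. -/
theorem addOn_left_left {b c : R} (hb : p * b = b) (hb' : b * p = 0) (hc : p * c = c) :
    AddOn φ b c := by
  have h0 := jordan_map_zero hφ.2 hJ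
  have key : ∀ b c t, p * b = b → b * p = 0 → p * c = c → c * p = 0 → p * t = 0 → t * p = 0 →
      AddOn φ ((1 / 2 : ℂ) • (b * t)) ((1 / 2 : ℂ) • c) := by
    intro b c t hb hb' hc hc' h1 h2
    have e1 : jordanMul p t = 0 := by rw [jordanMul_eq_zero_iff, h1, h2, add_zero]
    have e2 : jordanMul b c = 0 := by
      rw [jordanMul_eq_zero_iff, mul_eq_zero_of_mul_right hb' hc, mul_eq_zero_of_mul_right hc' hb,
        add_zero]
    have e3 : jordanMul p c = (1 / 2 : ℂ) • c := by rw [jordanMul, hc, hc', add_zero]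
    have e4 : jordanMul b t = (1 / 2 : ℂ) • (b * t) := by
      rw [jordanMul, mul_eq_zero_of_mul_right h2 hb, add_zero]
    have e5 : jordanMul (p + b) (t + c) = (1 / 2 : ℂ) • (b * t) + (1 / 2 : ℂ) • c := by
      rw [add_jordanMul, jordanMul_add, jordanMul_add, e1, e2, e3, e4]; abel
    rw [AddOn, ← e5, hJ, addOn_corner_left hφ hJ hp hp.idem hp.idem hb hb',
      addOn_cocorner_left hφ hJ hp h1 h2 hc hc', add_jordanMul, jordanMul_add, jordanMul_add,
      ← hJ, ← hJ, ← hJ, ← hJ, e1, e2, e3, e4, h0]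
    abel
  refine addOn_of_annihilator hφ hJ fun z h h' => ?_
  have hz := hp.eq_corner z fun t h1 h2 => by
    rw [← jordanMul_eq_zero_iff]
    apply h
    rw [jordanMul, jordanMul, mul_eq_zero_of_mul_right h2 hb, mul_eq_zero_of_mul_right h2 hc,
      add_zero, add_zero]
    exact key b (c * t) t hb hb' (by rw [← mul_assoc, hc]) (by rw [mul_assoc, h2, mul_zero]) h1 h2
  refine hp.corner_left z hz.2 fun t h1 h2 => ?_
  have : jordanMul z t = 0 := by
    apply h
    rw [jordanMul_eq_zero_iff (x := b).2]
    · exact addOn_zero_left h0 _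
    · rw [mul_eq_zero_of_mul_right hb' h1, mul_eq_zero_of_mul_right h2 hb, add_zero]
  rw [jordanMul_eq_zero_iff, mul_eq_zero_of_mul_right h2 hz.1, add_zero] at this
  exact this

theorem addOn_right_right {b c : R} (hb : p * b = 0) (hb' : b * p = b) (hc' : c * p = c) :
    AddOn φ b c := by
  have h0 := jordan_map_zero hφ.2 hJ
  have key : ∀ b c t, p * b = 0 → b * p = b → p * c = 0 → c * p = c → p * t = 0 → t * p = 0 →
      AddOn φ ((1 / 2 : ℂ) • (t * b)) ((1 / 2 : ℂ) • c) := by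
    intro b c t hb hb' hc hc' h1 h2
    have e1 : jordanMul p t = 0 := by rw [jordanMul_eq_zero_iff, h1, h2, add_zero]
    have e2 : jordanMul b c = 0 := by
      rw [jordanMul_eq_zero_iff, mul_eq_zero_of_mul_left hb' hc, mul_eq_zero_of_mul_left hc' hb,
        add_zero]
    have e3 : jordanMul p c = (1 / 2 : ℂ) • c := by rw [jordanMul, hc, hc', zero_add]
    have e4 : jordanMul b t = (1 / 2 : ℂ) • (t * b) := by
      rw [jordanMul, mul_eq_zero_of_mul_left hb' h1, zero_add]
    have e5 : jordanMul (p + b) (t + c) = (1 / 2 : ℂ) • (t * b) + (1 / 2 : ℂ) • c := by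
      rw [add_jordanMul, jordanMul_add, jordanMul_add, e1, e2, e3, e4]; abel
    rw [AddOn, ← e5, hJ, addOn_corner_right hφ hJ hp hp.idem hp.idem hb hb',
      addOn_cocorner_right hφ hJ hp h1 h2 hc hc', add_jordanMul, jordanMul_add, jordanMul_add,
      ← hJ, ← hJ, ← hJ, ← hJ, e1, e2, e3, e4, h0]
    abel
  refine addOn_of_annihilator hφ hJ fun z h h' => ?_
  have hz := hp.eq_corner z fun t h1 h2 => by
    rw [← jordanMul_eq_zero_iff]
    apply h
    rw [jordanMul, jordanMul, mul_eq_zero_of_mul_left hb' h1, mul_eq_zero_of_mul_left hc' h1,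
      zero_add, zero_add]
    exact key b (t * c) t hb hb' (by rw [← mul_assoc, h1, zero_mul]) (by rw [mul_assoc, hc']) h1 h2
  refine hp.corner_right z hz.1 fun t h1 h2 => ?_
  have : jordanMul z t = 0 := by
    apply h
    rw [jordanMul_eq_zero_iff (x := b).2]
    · exact addOn_zero_left h0 _
    · rw [mul_eq_zero_of_mul_left hb' h1, mul_eq_zero_of_mul_left h2 hb, add_zero]
  rw [jordanMul_eq_zero_iff, mul_eq_zero_of_mul_left hz.2 h1, zero_add] at this
  exact this

theorem addOn_corner_corner {a b : R} (ha : p * a = a) (ha' : a * p = a) (hb : p * b = b) :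
    AddOn φ a b := by
  have h0 := jordan_map_zero hφ.2 hJ
  refine addOn_of_annihilator hφ hJ fun z h _ => ?_
  have hz := hp.eq_corner z fun t h1 h2 => by
    rw [← jordanMul_eq_zero_iff]
    apply h
    rw [jordanMul_eq_zero_iff.2]
    · exact addOn_zero_left h0 _
    · rw [mul_eq_zero_of_mul_left ha' h1, mul_eq_zero_of_mul_right h2 ha, add_zero]
  refine hp.corner_left z hz.2 fun t h1 h2 => ?_
  have : jordanMul z t = 0 := by
    apply h
    rw [jordanMul, jordanMul, mul_eq_zero_of_mul_right h2 ha, mul_eq_zero_of_mul_right h2 hb,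
      add_zero, add_zero]
    -- Multiplication by `t` has moved both corner terms into `p R (1 - p)`.
    apply addOn_left_left hφ hJ hp
    all_goals
      simp only [mul_smul_comm, smul_mul_assoc, ← mul_assoc, ha, hb]
      try simp only [mul_assoc, h2, mul_zero, smul_zero]
  rw [jordanMul_eq_zero_iff, mul_eq_zero_of_mul_right h2 hz.1, add_zero] at this
  exact this

theorem addOn_cocorner_cocorner {d e : R} (hd : p * d = 0) (hd' : d * p = 0)
    (he' : e * p = 0) : AddOn φ d e := by
  have h0 := jordan_map_zero hφ.2 hJ
  refine addOn_of_annihilator hφ hJ fun z h _ => ?_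
  have hz := hp.mul_eq_zero_of_jordan (z := z) <| by
    apply h
    rw [jordanMul_eq_zero_iff.2]
    · exact addOn_zero_left h0 _
    · rw [hd, hd', add_zero]
  refine hp.left z hz.1 fun t h1 h2 => ?_
  have : jordanMul z t = 0 := by
    apply h
    rw [jordanMul, jordanMul, mul_eq_zero_of_mul_right hd' h1, mul_eq_zero_of_mul_right he' h1,
      zero_add, zero_add]
    apply addOn_left_left hφ hJ hp
    all_goals
      simp only [mul_smul_comm, smul_mul_assoc, ← mul_assoc, h1]
      try simp only [mul_assoc, hd', mul_zero, smul_zero]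
  rw [jordanMul_eq_zero_iff, mul_eq_zero_of_mul_right hz.2 h1, zero_add] at this
  exact this

/-- A bijective Jordan multiplicative map is additive as soon as its domain has a Peirce faithful
idempotent. -/
theorem jordan_map_add (x y : R) : φ (x + y) = φ x + φ y := by
  have hsplit : ∀ a b c d, p * a = a → a * p = a → p * b = b → b * p = 0 → p * c = 0 →
      c * p = c → p * d = 0 → d * p = 0 →
      φ (a + (b + c) + d) = φ a + (φ b + φ c) + φ d := by
    intro a b c d ha ha' hb hb' hc hc' hd hd'
    rw [addOn_peirce hφ hJ hp ha ha' hb hc' hd hd',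
      addOn_corner_offdiag hφ hJ hp ha ha' hb hb' hc hc', addOn_left_right hφ hJ hp hb hb' hc hc']
  have hc : ∀ x, p * (p * x * p) = p * x * p ∧ (p * x * p) * p = p * x * p ∧
      p * (p * x - p * x * p) = p * x - p * x * p ∧ (p * x - p * x * p) * p = 0 ∧
      p * (x * p - p * x * p) = 0 ∧ (x * p - p * x * p) * p = x * p - p * x * p ∧
      p * (x - p * x - x * p + p * x * p) = 0 ∧ (x - p * x - x * p + p * x * p) * p = 0 := by
    intro x
    have h1 : ∀ y, p * (p * y) = p * y := fun y => by rw [← mul_assoc, hp.idem]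
    refine ⟨?_, ?_, ?_, ?_, ?_, ?_, ?_, ?_⟩ <;>
      simp only [mul_sub, sub_mul, mul_add, add_mul, mul_assoc, hp.idem, h1] <;> abel
  have hx : ∀ x, x = p * x * p + ((p * x - p * x * p) + (x * p - p * x * p)) +
      (x - p * x - x * p + p * x * p) := fun x => by abel
  have hφx : ∀ x, φ x = φ (p * x * p) + (φ (p * x - p * x * p) + φ (x * p - p * x * p)) +
      φ (x - p * x - x * p + p * x * p) := fun x => by
    obtain ⟨h1, h2, h3, h4, h5, h6, h7, h8⟩ := hc x
    rw [← hsplit _ _ _ _ h1 h2 h3 h4 h5 h6 h7 h8, ← hx]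
  obtain ⟨h1, h2, h3, h4, h5, h6, h7, h8⟩ := hc x
  obtain ⟨k1, k2, k3, k4, k5, k6, k7, k8⟩ := hc y
  rw [hφx (x + y), hφx x, hφx y]
  have e1 : φ (p * (x + y) * p) = φ (p * x * p) + φ (p * y * p) := by
    rw [mul_add, add_mul]; exact addOn_corner_corner hφ hJ hp h1 h2 k1
  have e2 : φ (p * (x + y) - p * (x + y) * p) = φ (p * x - p * x * p) + φ (p * y - p * y * p) := by
    rw [mul_add, add_mul, add_sub_add_comm]; exact addOn_left_left hφ hJ hp h3 h4 k3
  have e3 : φ ((x + y) * p - p * (x + y) * p) = φ (x * p - p * x * p) + φ (y * p - p * y * p) := by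
    rw [mul_add, add_mul, add_mul, add_sub_add_comm]; exact addOn_right_right hφ hJ hp h5 h6 k6
  have e4 : φ (x + y - p * (x + y) - (x + y) * p + p * (x + y) * p) =
      φ (x - p * x - x * p + p * x * p) + φ (y - p * y - y * p + p * y * p) := by
    rw [← show _ = _ from addOn_cocorner_cocorner hφ hJ hp h7 h8 k8]
    congr 1
    rw [mul_add, add_mul, add_mul]; abel
  rw [e1, e2, e3, e4]; abel

end Pairs
end Additivity

/-! ### Jordan maps onto prime algebras -/

section Herstein

set_option linter.unusedSectionVars false

/-- A non-unital ring is prime in the elementwise sense: `a R b = 0` forces `a = 0` or `b = 0`. -/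
def IsPrimeElementwise (S : Type*) [NonUnitalRing S] : Prop :=
  ∀ a b : S, (∀ r, a * r * b = 0) → a = 0 ∨ b = 0

/-- Moving the signs through `(a r b) s (a r b)` in two ways yields opposite values, so it vanishes
for all `s`; primeness is then used twice. -/
theorem IsPrimeElementwise.of_mul_add_mul {S : Type*} [NonUnitalRing S] [Module ℂ S]
    (hS : IsPrimeElementwise S) {a b : S} (h : ∀ r, a * r * b + b * r * a = 0) :
    a = 0 ∨ b = 0 := by
  have h' : ∀ r, a * r * b = - (b * r * a) := fun r => eq_neg_of_add_eq_zero_left (h r)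
  have key : ∀ r s, (a * r * b) * s * (a * r * b) = 0 := by
    intro r s
    have e1 : (a * r * b) * s * (a * r * b) = -(b * r * b * s * a * r * a) := by
      calc (a * r * b) * s * (a * r * b) = a * (r * b * s * a * r) * b := by
            simp only [mul_assoc]
        _ = -(b * r * (b * s * a) * r * a) := by rw [h']; simp only [mul_assoc]
        _ = _ := by simp only [mul_assoc]
    have e2 : (a * r * b) * s * (a * r * b) = b * r * b * s * a * r * a := by
      calc (a * r * b) * s * (a * r * b) = -(a * (r * b * s) * b * r * a) := by
            rw [h' r, mul_neg, ← h' r]; simp only [mul_assoc]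
        _ = b * r * b * s * a * r * a := by
            rw [h']; simp only [mul_assoc, neg_mul, neg_neg]
    have e3 : (2 : ℂ) • ((a * r * b) * s * (a * r * b)) = 0 := by
      rw [two_smul]; nth_rewrite 1 [e1]; rw [e2, neg_add_cancel]
    simpa using e3
  refine hS a b fun r => ?_
  rcases hS _ _ (key r) with h | h <;> exact h

/-- An additive group is not the union of two proper subgroups. -/
theorem forall_or_forall_of_add {G : Type*} [AddGroup G] {P Q : G → Prop}
    (hP : ∀ x y, P x → P y → P (x + y)) (hP' : ∀ x, P x → P (-x))
    (hQ : ∀ x y, Q x → Q y → Q (x + y)) (hQ' : ∀ x, Q x → Q (-x))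
    (h : ∀ x, P x ∨ Q x) : (∀ x, P x) ∨ (∀ x, Q x) := by
  by_contra! hc
  obtain ⟨⟨x, hx⟩, y, hy⟩ := hc
  have hx' := (h x).resolve_left hx
  have hy' := (h y).resolve_right hy
  rcases h (x + y) with h1 | h1
  · exact hx (by simpa using hP _ _ h1 (hP' _ hy'))
  · exact hy (by simpa using hQ _ _ (hQ' _ hx') h1)

variable {R S : Type*} [NonUnitalRing R] [Module ℂ R] [IsScalarTower ℂ R R] [SMulCommClass ℂ R R]
  [NonUnitalRing S] [Module ℂ S] [IsScalarTower ℂ S S] [SMulCommClass ℂ S S]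

/-- Herstein's theorem: an additive Jordan map onto a prime algebra is a homomorphism or an
antihomomorphism. -/
theorem jordan_hom_or_antihom (hS : IsPrimeElementwise S) {φ : R → S}
    (hs : Function.Surjective φ) (hadd : ∀ x y, φ (x + y) = φ x + φ y)
    (hJ : ∀ x y, φ (jordanMul x y) = jordanMul (φ x) (φ y)) :
    (∀ x y, φ (x * y) = φ x * φ y) ∨ (∀ x y, φ (x * y) = φ y * φ x) := by
  let f : R →+ S := AddMonoidHom.mk' φ hadd
  have two : ∀ {u v : S}, u + u = v + v → u = v := fun {u v} h => by
    rw [← two_smul ℂ, ← two_smul ℂ v] at h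
    exact smul_right_injective S (two_ne_zero (α := ℂ)) h
  have hj : ∀ x y, f (x * y) + f (y * x) = f x * f y + f y * f x := by
    intro x y
    have e : ∀ x y : R, jordanMul x y + jordanMul x y = x * y + y * x := fun x y => by
      rw [jordanMul, ← smul_add, ← two_smul ℂ, smul_smul]; norm_num
    have e' : ∀ x y : S, jordanMul x y + jordanMul x y = x * y + y * x := fun x y => by
      rw [jordanMul, ← smul_add, ← two_smul ℂ, smul_smul]; norm_num
    rw [← map_add, ← e, map_add, ← e']
    exact congrArg₂ _ (hJ x y) (hJ x y)
  have hj' : ∀ x y, f (x * y) = f x * f y + f y * f x - f (y * x) := fun x y =>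
    eq_sub_of_add_eq (hj x y)
  -- From `2aba = a(ab + ba) + (ab + ba)a - (a²b + ba²)`.
  have htriple : ∀ a b, f (a * b * a) = f a * f b * f a := by
    intro a b
    apply two
    have h1 := hj a (a * b + b * a)
    have h2 := hj (a * a) b
    have h3 : f (a * a) = f a * f a := two (hj a a)
    rw [map_add, hj a b] at h1
    simp only [mul_add, add_mul, map_add, h3] at h1 h2
    simp only [← mul_assoc] at h1 h2
    have : f (a * b * a) + f (a * b * a) = f (a * a * b) + f (a * b * a) +
      (f (a * b * a) + f (b * a * a)) - (f (a * a * b) + f (b * a * a)) := by abel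
    rw [this, h1, h2]
    abel
  have htriple' : ∀ a b c, f (a * b * c) + f (c * b * a) = f a * f b * f c + f c * f b * f a := by
    intro a b c
    have h1 := htriple (a + c) b
    simp only [add_mul, mul_add, map_add, htriple] at h1
    have : f (a * b * c) + f (c * b * a) = (f a * f b * f a + f (c * b * a) +
      (f (a * b * c) + f c * f b * f c)) - f a * f b * f a - f c * f b * f c := by abel
    rw [this, h1]
    abel
  -- The value of `f` at `ab r ba + ba r ab` is computed by `htriple'` and also by nesting
  -- `htriple`. The difference is exactly `u r v + v r u` up to sign, with `u`, `v` the deviations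
  -- from the two multiplicative laws.
  have hpair : ∀ a b, f (a * b) = f a * f b ∨ f (a * b) = f b * f a := by
    intro a b
    rw [← sub_eq_zero, ← sub_eq_zero (b := f b * f a)]
    refine hS.of_mul_add_mul fun r' => ?_
    obtain ⟨r, rfl⟩ := hs r'
    change (f (a * b) - f a * f b) * f r * (f (a * b) - f b * f a) +
      (f (a * b) - f b * f a) * f r * (f (a * b) - f a * f b) = 0
    have h1 := htriple' (a * b) r (b * a)
    have h2 : f (a * b * r * (b * a)) = f a * (f b * f r * f b) * f a := by
      rw [← htriple, ← htriple]; simp only [mul_assoc]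
    have h3 : f (b * a * r * (a * b)) = f b * (f a * f r * f a) * f b := by
      rw [← htriple, ← htriple]; simp only [mul_assoc]
    rw [h2, h3, hj' b a] at h1
    simp only [sub_mul, mul_sub, add_mul, mul_add, ← mul_assoc] at h1 ⊢
    rw [← sub_eq_zero] at h1
    rw [← h1]
    abel
  have hrow : ∀ a, (∀ b, f (a * b) = f a * f b) ∨ (∀ b, f (a * b) = f b * f a) := by
    intro a
    exact forall_or_forall_of_add
      (P := fun b => f (a * b) = f a * f b) (Q := fun b => f (a * b) = f b * f a)
      (fun x y hx hy => by rw [mul_add, map_add, map_add, hx, hy, mul_add])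
      (fun x hx => by rw [mul_neg, map_neg, map_neg, hx, mul_neg])
      (fun x y hx hy => by rw [mul_add, map_add, map_add, hx, hy, add_mul])
      (fun x hx => by rw [mul_neg, map_neg, map_neg, hx, neg_mul]) (hpair a)
  exact forall_or_forall_of_add
    (P := fun a => ∀ b, f (a * b) = f a * f b) (Q := fun a => ∀ b, f (a * b) = f b * f a)
    (fun x y hx hy b => by rw [add_mul, map_add, map_add, hx b, hy b, add_mul])
    (fun x hx b => by rw [neg_mul, map_neg, map_neg, hx b, neg_mul])
    (fun x y hx hy b => by rw [add_mul, map_add, map_add, hx b, hy b, mul_add])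
    (fun x hx b => by rw [neg_mul, map_neg, map_neg, hx b, mul_neg]) hrow

end Herstein

/-! ### Rank one operators and semilinear implementation -/

section Operators

variable {X : Type*} [NormedAddCommGroup X] [NormedSpace ℂ X]
  {𝒜 : NonUnitalSubalgebra ℂ (X →L[ℂ] X)}

/-- The rank one operator `v ↦ f v • x` as an element of a standard operator algebra. -/
noncomputable def IsStandardOperatorAlgebra.rankOne (h𝒜 : IsStandardOperatorAlgebra 𝒜)
    (f : StrongDual ℂ X) (x : X) : 𝒜 :=
  ⟨f.smulRight x, h𝒜 _ <| by
    refine Submodule.finiteDimensional_of_le (S₂ := Submodule.span ℂ {x}) ?_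
    rintro _ ⟨v, rfl⟩
    exact Submodule.smul_mem _ _ (Submodule.mem_span_singleton_self x)⟩

theorem NonUnitalSubalgebra.operator_ext {A B : 𝒜}
    (h : ∀ v, (A : X →L[ℂ] X) v = (B : X →L[ℂ] X) v) : A = B :=
  Subtype.ext (ContinuousLinearMap.ext h)

namespace IsStandardOperatorAlgebra

variable (h𝒜 : IsStandardOperatorAlgebra 𝒜)

@[simp]
theorem rankOne_apply (f : StrongDual ℂ X) (x v : X) :
    (h𝒜.rankOne f x : X →L[ℂ] X) v = f v • x := rfl

theorem mul_rankOne (A : 𝒜) (f : StrongDual ℂ X) (x : X) :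
    A * h𝒜.rankOne f x = h𝒜.rankOne f ((A : X →L[ℂ] X) x) :=
  NonUnitalSubalgebra.operator_ext fun v =>
    show (A : X →L[ℂ] X) (f v • x) = f v • (A : X →L[ℂ] X) x from map_smul _ _ _

theorem rankOne_mul (A : 𝒜) (f : StrongDual ℂ X) (x : X) :
    h𝒜.rankOne f x * A = h𝒜.rankOne (f.comp (A : X →L[ℂ] X)) x :=
  NonUnitalSubalgebra.operator_ext fun _ => rfl

theorem rankOne_smul (c : ℂ) (f : StrongDual ℂ X) (x : X) :
    h𝒜.rankOne f (c • x) = h𝒜.rankOne (c • f) x :=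
  NonUnitalSubalgebra.operator_ext fun v => by simp [smul_smul, mul_comm]

include h𝒜 in
-- Sandwiching `f ⊗ u` gives `(f ∘ b) ⊗ (a u)`, nonzero when `a u ≠ 0` and `f (b v) = 1`.
theorem isPrimeElementwise : IsPrimeElementwise 𝒜 := by
  intro a b h
  by_contra! hc
  obtain ⟨ha, hb⟩ := hc
  obtain ⟨u, hu⟩ : ∃ u, (a : X →L[ℂ] X) u ≠ 0 := by
    by_contra! h; exact ha (NonUnitalSubalgebra.operator_ext h)
  obtain ⟨v, hv⟩ : ∃ v, (b : X →L[ℂ] X) v ≠ 0 := by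
    by_contra! h; exact hb (NonUnitalSubalgebra.operator_ext h)
  obtain ⟨f, hf⟩ := SeparatingDual.exists_eq_one (R := ℂ) hv
  have := h (h𝒜.rankOne f u)
  rw [mul_rankOne, rankOne_mul] at this
  have := congrArg (fun A : 𝒜 => (A : X →L[ℂ] X) v) this
  simp [hf] at this
  exact hu this

theorem isPeirceFaithful_rankOne {f₀ : StrongDual ℂ X} {x₀ : X} (h₀ : f₀ x₀ = 1)
    (hX : 1 < Module.rank ℂ X) : IsPeirceFaithful (h𝒜.rankOne f₀ x₀) := by
  -- Dimension above one supplies a nonzero vector in `ker f₀`; without it the off-diagonal spaces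
  -- would be zero and could not detect the corner.
  obtain ⟨u₀, hu₀, hu₀'⟩ : ∃ u, f₀ u = 0 ∧ u ≠ 0 := by
    by_contra! h
    refine hX.not_ge (rank_le_one_iff.2 ⟨x₀, fun v => ⟨f₀ v, ?_⟩⟩)
    rw [eq_comm, ← sub_eq_zero]
    exact h _ (by simp [h₀])
  have hdual : ∀ u, f₀ u = 0 → u ≠ 0 → ∃ g : StrongDual ℂ X, g x₀ = 0 ∧ g u = 1 := by
    intro u hu hu'
    obtain ⟨g, hg⟩ := SeparatingDual.exists_eq_one (R := ℂ) hu'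
    exact ⟨g - g x₀ • f₀, by simp [h₀], by simp [hu, hg]⟩
  have hdecomp : ∀ (z : X →L[ℂ] X) v, z v = f₀ v • z x₀ + z (v - f₀ v • x₀) := fun z v => by
    simp
  have hsep : ∀ v, (∀ g : StrongDual ℂ X, g x₀ = 0 → g v = 0) → v = f₀ v • x₀ := by
    intro v hv
    rw [SeparatingDual.eq_iff_forall_dual_eq (R := ℂ)]
    intro g
    have := hv (g - g x₀ • f₀) (by simp [h₀])
    simp only [_root_.sub_apply, _root_.smul_apply, smul_eq_mul,
      sub_eq_zero] at this
    simp [this, mul_comm]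
  have hL : ∀ z : 𝒜, (∀ v, (z : X →L[ℂ] X) v = f₀ ((z : X →L[ℂ] X) v) • x₀) →
      h𝒜.rankOne f₀ x₀ * z = z := fun z hz =>
    NonUnitalSubalgebra.operator_ext fun v => (hz v).symm
  have hR : ∀ z : 𝒜, (∀ u, f₀ u = 0 → (z : X →L[ℂ] X) u = 0) →
      z * h𝒜.rankOne f₀ x₀ = z := fun z hz => by
    rw [mul_rankOne]
    refine NonUnitalSubalgebra.operator_ext fun v => ?_
    rw [hdecomp z v, hz (v - f₀ v • x₀) (by simp [h₀]), add_zero, rankOne_apply]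
  have app : ∀ {z w : 𝒜}, z = w → ∀ v, (z : X →L[ℂ] X) v = (w : X →L[ℂ] X) v := by
    rintro z _ rfl _; rfl
  have hzero : ∀ f : StrongDual ℂ X, f = 0 → ∀ x, h𝒜.rankOne f x = 0 := by
    rintro _ rfl x
    exact NonUnitalSubalgebra.operator_ext fun v => by simp
  have hzero' : ∀ f : StrongDual ℂ X, h𝒜.rankOne f 0 = 0 := by
    exact fun f => NonUnitalSubalgebra.operator_ext fun v => by simp
  have hpt : ∀ g u, f₀ u = 0 → h𝒜.rankOne f₀ x₀ * h𝒜.rankOne g u = 0 := fun g u hu => by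
    simp [mul_rankOne, hu, hzero']
  have htp : ∀ g u, g x₀ = 0 → h𝒜.rankOne g u * h𝒜.rankOne f₀ x₀ = 0 := fun g u hg => by
    simp [mul_rankOne, hg, hzero']
  have hpt' : ∀ g, h𝒜.rankOne f₀ x₀ * h𝒜.rankOne g x₀ = h𝒜.rankOne g x₀ := fun g => by
    simp [mul_rankOne, h₀]
  have htp' : ∀ u, h𝒜.rankOne f₀ u * h𝒜.rankOne f₀ x₀ = h𝒜.rankOne f₀ u := fun u => by
    simp [mul_rankOne, h₀]
  refine ⟨hpt' f₀, fun z hz => ?_, fun z hz hz' => ?_, fun z hz hz' => ?_, fun z hz hz' => ?_,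
    fun z hz hz' => ?_⟩
  -- The test `g ⊗ u` lies in the cocorner. Evaluating its relation at `u` and applying `g` gives `2
  -- g (z u) = 0`, from which both claims follow.
  · have key : ∀ (g : StrongDual ℂ X) (u : X), f₀ u = 0 → g x₀ = 0 → g u = 1 →
        (z : X →L[ℂ] X) u = 0 ∧ ∀ v, g ((z : X →L[ℂ] X) v) = 0 := by
      intro g u hu hg hgu
      have h1 : ∀ v, g v • (z : X →L[ℂ] X) u + g ((z : X →L[ℂ] X) v) • u = 0 := fun v => by
        have := hz (h𝒜.rankOne g u) (hpt g u hu) (htp g u hg)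
        rw [mul_rankOne, rankOne_mul] at this
        exact app this v
      have h2 := h1 u
      rw [hgu, one_smul] at h2
      have h3 := congrArg g h2
      simp only [map_add, map_smul, hgu, smul_eq_mul, mul_one, map_zero, ← two_mul] at h3
      have h4 : g ((z : X →L[ℂ] X) u) = 0 := by simpa using h3
      rw [h4, zero_smul, add_zero] at h2
      refine ⟨h2, fun v => ?_⟩
      have h5 := congrArg g (h1 v)
      simpa [h2, hgu] using h5
    refine ⟨hL z fun v => hsep _ fun g hg => ?_, hR z fun u hu => ?_⟩
    · by_cases hg' : g = 0
      · simp [hg']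
      obtain ⟨u, hu⟩ : ∃ u, g u ≠ 0 := by
        by_contra! h; exact hg' (ContinuousLinearMap.ext h)
      refine (key g ((g u)⁻¹ • (u - f₀ u • x₀)) ?_ hg ?_).2 v
      · simp [h₀]
      · simp [hg, hu]
    · by_cases hu' : u = 0
      · simp [hu']
      obtain ⟨g, hg, hg'⟩ := hdual u hu hu'
      exact (key g u hu hg hg').1
  · refine NonUnitalSubalgebra.operator_ext fun v => ?_
    have hx₀ : x₀ ≠ 0 := by rintro rfl; simp at h₀
    rw [hsep ((z : X →L[ℂ] X) v) fun g hg => ?_]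
    · exact app hz v
    · have := app (hz' (h𝒜.rankOne g x₀) (hpt' g) (htp g x₀ hg)) v
      rw [rankOne_mul] at this
      simpa [hx₀] using this
  · rw [← hR z fun u hu => ?_, hz]
    have := app (hz' (h𝒜.rankOne f₀ u) (hpt f₀ u hu) (htp' u)) x₀
    rw [mul_rankOne] at this
    simpa [h₀] using this
  · obtain ⟨g, hg, hg'⟩ := hdual u₀ hu₀ hu₀'
    have := app (hz' (h𝒜.rankOne g x₀) (hpt' g) (htp g x₀ hg)) u₀
    rw [mul_rankOne] at this
    have h1 : (z : X →L[ℂ] X) x₀ = 0 := by simpa [hg'] using this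
    rw [← hz, mul_rankOne, h1, hzero']
  · have h1 : ∀ v, f₀ ((z : X →L[ℂ] X) v) = 0 := fun v => by
      have := app (hz' (h𝒜.rankOne f₀ u₀) (hpt f₀ u₀ hu₀) (htp' u₀)) v
      rw [rankOne_mul] at this
      simpa [hu₀'] using this
    rw [← hz, rankOne_mul]
    exact hzero _ (ContinuousLinearMap.ext h1) _

include h𝒜 in
/-- A rank one idempotent is carried by a ring isomorphism onto a rank one idempotent, so that the
isomorphism is implemented by a semilinear bijection. Here `ρ` is an action of `R` on `E`, and
`ι e₀` is the idempotent. -/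
theorem exists_semilinear_of_ringEquiv {R E : Type*} [NonUnitalRing R] [AddCommGroup E] [Module ℂ E]
    (ψ : R ≃+* 𝒜) (ι : E →+ R) (hι : Function.Injective ι) (ρ : R → E → E) (e₀ : E)
    (he₀ : e₀ ≠ 0) (hρ : ∀ r e, r * ι e = ι (ρ r e))
    (hscal : ∀ (c : ℂ) (e : E), ι e * ι (c • e₀) = ι (c • e))
    (hcorner : ∀ r, ∃ c : ℂ, ι e₀ * r * ι e₀ = ι (c • e₀)) :
    ∃ (h : ℂ ≃+* ℂ) (T : E ≃+ X), (∀ (c : ℂ) e, T (c • e) = h c • T e) ∧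
      ∀ r e, T (ρ r e) = (ψ r : X →L[ℂ] X) (T e) := by
  have app : ∀ {z w : 𝒜}, z = w → ∀ v, (z : X →L[ℂ] X) v = (w : X →L[ℂ] X) v := by
    rintro z _ rfl _; rfl
  have hmul : ∀ (A B : 𝒜) v, ((A * B : 𝒜) : X →L[ℂ] X) v =
    (A : X →L[ℂ] X) ((B : X →L[ℂ] X) v) := fun _ _ _ => rfl
  have hunit : ∀ e, ι e * ι e₀ = ι e := fun e => by simpa using hscal 1 e
  set P : 𝒜 := ψ (ι e₀) with hP
  have hP0 : P ≠ 0 := fun h => he₀ (hι (ψ.injective (by rw [map_zero, map_zero]; exact h)))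
  obtain ⟨w, hw⟩ : ∃ w, (P : X →L[ℂ] X) w ≠ 0 := by
    by_contra! h; exact hP0 (NonUnitalSubalgebra.operator_ext h)
  have hPP : P * P = P := by rw [hP, ← map_mul, hunit]
  obtain ⟨y₀, hy₀, hPy₀⟩ : ∃ y, y ≠ 0 ∧ (P : X →L[ℂ] X) y = y :=
    ⟨_, hw, by rw [← hmul, hPP]⟩
  obtain ⟨g, hg⟩ := SeparatingDual.exists_eq_one (R := ℂ) hy₀
  have hcornerP : ∀ A : 𝒜, ∃ c : ℂ, P * A * P = ψ (ι (c • e₀)) := fun A => by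
    obtain ⟨r, rfl⟩ := ψ.surjective A
    obtain ⟨c, hc⟩ := hcorner r
    exact ⟨c, by rw [← hc, map_mul, map_mul]⟩
  have hcomm : ∀ A B : 𝒜, (P * A * P) * (P * B * P) = (P * B * P) * (P * A * P) := by
    intro A B
    obtain ⟨c, hc⟩ := hcornerP A
    obtain ⟨d, hd⟩ := hcornerP B
    rw [hc, hd, ← map_mul ψ, ← map_mul ψ, hscal, hscal, smul_smul, smul_smul, mul_comm]
  -- `P` has rank one: the corner at `P` is commutative, and commuting the compressions of `g ⊗ P v`
  -- and `g ⊗ y₀` at `y₀` gives `P v = g (P v) • y₀`.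
  have hrange : ∀ v, (P : X →L[ℂ] X) v = g ((P : X →L[ℂ] X) v) • y₀ := by
    intro v
    have h1 := app (hcomm (h𝒜.rankOne g ((P : X →L[ℂ] X) v)) (h𝒜.rankOne g y₀)) y₀
    have h2 : (P : X →L[ℂ] X) ((P : X →L[ℂ] X) v) = (P : X →L[ℂ] X) v := app hPP v
    simpa only [hmul, rankOne_apply, hPy₀, hg, one_smul, map_smul, h2] using h1
  -- the scalars
  have hscalar : ∀ c : ℂ, ∃ d : ℂ, (ψ (ι (c • e₀)) : X →L[ℂ] X) y₀ = d • y₀ := fun c => by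
    refine ⟨g ((P : X →L[ℂ] X) ((ψ (ι (c • e₀)) : X →L[ℂ] X) y₀)), ?_⟩
    rw [← hrange, hP, ← hmul, ← map_mul, hscal]
  choose h hh using hscalar
  have hinj : ∀ {a b : ℂ}, a • y₀ = b • y₀ → a = b := fun hab => smul_left_injective ℂ hy₀ hab
  -- `ψ (ι e) = ψ (ι e) * P`, and the range of `P` is spanned by `y₀`.
  have hfaith : ∀ e, (ψ (ι e) : X →L[ℂ] X) y₀ = 0 → e = 0 := by
    intro e he
    apply hι
    apply ψ.injective
    rw [map_zero, map_zero, ← hunit, map_mul]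
    refine NonUnitalSubalgebra.operator_ext fun v => ?_
    rw [hmul, ← hP, hrange, map_smul, he, smul_zero]; rfl
  have hTs : ∀ (c : ℂ) e, (ψ (ι (c • e)) : X →L[ℂ] X) y₀ = h c • (ψ (ι e) : X →L[ℂ] X) y₀ := by
    intro c e
    rw [← hscal, map_mul, hmul, hh, map_smul]
  have hadd : ∀ A B : R, ∀ v, (ψ (A + B) : X →L[ℂ] X) v =
      (ψ A : X →L[ℂ] X) v + (ψ B : X →L[ℂ] X) v := fun A B v => by rw [map_add]; rfl
  have hone : h 1 = 1 := hinj (by rw [← hh, one_smul, one_smul]; exact hPy₀)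
  have hhadd : ∀ a b, h (a + b) = h a + h b := fun a b => hinj (by
    rw [← hh, add_smul, add_smul, map_add, hadd, hh, hh])
  have hhmul : ∀ a b, h (a * b) = h a * h b := fun a b => hinj (by
    rw [← hh, mul_smul, hTs, hh, smul_smul])
  have hhinj : Function.Injective h := by
    intro a b hab
    have h1 : h (a - b) = 0 := by
      have := hhadd (a - b) b
      rw [sub_add_cancel, hab] at this
      simpa using this
    have h2 := hh (a - b)
    rw [h1, zero_smul] at h2
    have h3 := hfaith _ h2
    rwa [smul_eq_zero, or_iff_left he₀, sub_eq_zero] at h3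
  have hhsurj : Function.Surjective h := by
    intro d
    obtain ⟨c, hc⟩ := hcornerP (h𝒜.rankOne (d • g) y₀)
    refine ⟨c, hinj ?_⟩
    rw [← hh, ← hc, hmul, hmul, rankOne_apply, hPy₀]
    simp [hg, hPy₀]
  let T₀ : E →+ X := AddMonoidHom.mk' (fun e => (ψ (ι e) : X →L[ℂ] X) y₀) fun a b => by
    rw [map_add, hadd]
  have hTρ : ∀ r e, T₀ (ρ r e) = (ψ r : X →L[ℂ] X) (T₀ e) := fun r e => by
    change (ψ (ι (ρ r e)) : X →L[ℂ] X) y₀ = (ψ r : X →L[ℂ] X) ((ψ (ι e) : X →L[ℂ] X) y₀)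
    rw [← hρ, map_mul, hmul]
  have hTbij : Function.Bijective T₀ := by
    refine ⟨(injective_iff_map_eq_zero T₀).2 hfaith, fun y => ?_⟩
    obtain ⟨r, hr⟩ := ψ.surjective (h𝒜.rankOne g y)
    refine ⟨ρ r e₀, ?_⟩
    rw [hTρ, hr]
    change g ((P : X →L[ℂ] X) y₀) • y = y
    rw [hPy₀, hg, one_smul]
  exact ⟨RingEquiv.ofBijective
      ({ toFun := h, map_one' := hone, map_mul' := hhmul, map_add' := hhadd,
         map_zero' := by simpa using hhadd 0 0 } : ℂ →+* ℂ) ⟨hhinj, hhsurj⟩,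
    AddEquiv.ofBijective T₀ hTbij, hTs, hTρ⟩

end IsStandardOperatorAlgebra
end Operators

/-! ### Automatic continuity in infinite dimension -/

section Continuity

open Filter Topology

/-- An additive map of `ℂ` which is bounded near `0` is continuous. -/
theorem AddMonoidHom.continuous_of_bounded_near_zero (k : ℂ →+ ℂ) {δ C : ℝ} (hδ : 0 < δ)
    (hC : ∀ c, ‖c‖ ≤ δ → ‖k c‖ ≤ C) : Continuous k := by
  refine continuous_of_continuousAt_zero k ?_
  rw [ContinuousAt, map_zero, Metric.tendsto_nhds_nhds]
  intro ε hε
  obtain ⟨N, hN⟩ := exists_nat_gt (C / ε)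
  have hN0 : (0 : ℝ) < N + 1 := by positivity
  refine ⟨δ / (N + 1), by positivity, fun {c} hc => ?_⟩
  rw [dist_zero_right] at hc ⊢
  have h1 : ‖k ((N + 1) • c)‖ ≤ C := by
    refine hC _ ?_
    rw [nsmul_eq_mul, norm_mul, Complex.norm_natCast, mul_comm]
    push_cast
    exact ((lt_div_iff₀ hN0).1 hc).le
  rw [map_nsmul, nsmul_eq_mul, norm_mul, Complex.norm_natCast] at h1
  push_cast at h1
  rw [div_lt_iff₀ hε] at hN
  by_contra! h
  nlinarith

/-- An infinite dimensional normed space contains an infinite biorthogonal sequence. -/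
theorem exists_biorthogonal_sequence {X : Type*} [NormedAddCommGroup X] [NormedSpace ℂ X]
    (hX : ¬ FiniteDimensional ℂ X) : ∃ (x : ℕ → X) (f : ℕ → StrongDual ℂ X),
      (∀ n, f n (x n) = 1) ∧ ∀ m n, m ≠ n → f m (x n) = 0 := by
  obtain ⟨s, hs, hs'⟩ := exists_seq_of_forall_finset_exists
    (fun p : X × StrongDual ℂ X => p.2 p.1 = 1) (fun p q => p.2 q.1 = 0 ∧ q.2 p.1 = 0) <| by
    classical
    intro s _
    let W : Submodule ℂ X := Submodule.span ℂ ((s.image Prod.fst : Finset X) : Set X)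
    let L : X →ₗ[ℂ] (s → ℂ) := LinearMap.pi fun p => ((p : X × StrongDual ℂ X).2 : X →ₗ[ℂ] ℂ)
    -- The common kernel of the earlier functionals has finite codimension, so it cannot lie in the
    -- finite-dimensional span `W` of the earlier vectors.
    obtain ⟨y, hy, hyW⟩ : ∃ y, y ∈ LinearMap.ker L ∧ y ∉ W := by
      by_contra! h
      have : FiniteDimensional ℂ (LinearMap.ker L) := Submodule.finiteDimensional_of_le h
      have : FiniteDimensional ℂ (X ⧸ LinearMap.ker L) :=
        LinearEquiv.finiteDimensional L.quotKerEquivRange.symm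
      exact hX (Module.Finite.of_submodule_quotient (LinearMap.ker L))
    -- Composing with `1 - π`, for a bounded projection `π` onto `W`, makes the new functional
    -- vanish on the earlier vectors.
    obtain ⟨π, hπ⟩ := Submodule.ClosedComplemented.of_finiteDimensional W
    have hne : y - (π y : X) ≠ 0 := fun h => hyW (by rw [sub_eq_zero.1 h]; exact (π y).2)
    obtain ⟨g, hg⟩ := SeparatingDual.exists_eq_one (R := ℂ) hne
    have hgW : ∀ w ∈ W, g (w - (π w : X)) = 0 := fun w hw => by
      rw [hπ ⟨w, hw⟩]; simp
    refine ⟨(y, g.comp (ContinuousLinearMap.id ℂ X - W.subtypeL.comp π)), hg, fun p hp => ⟨?_, ?_⟩⟩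
    · exact congrFun (LinearMap.mem_ker.1 hy) ⟨p, hp⟩
    · exact hgW _ (Submodule.subset_span (by
        simpa using ⟨p.2, hp⟩))
  refine ⟨fun n => (s n).1, fun n => (s n).2, hs, fun m n hmn => ?_⟩
  rcases lt_or_gt_of_ne hmn with h | h
  · exact (hs' m n h).1
  · exact (hs' n m h).2

variable {E Y : Type*} [NormedAddCommGroup E] [NormedSpace ℂ E]
  [NormedAddCommGroup Y] [NormedSpace ℂ Y] [CompleteSpace Y]

/-- The gliding hump: the scalar automorphism of a semilinear bijection is continuous if enough
functionals are transported to continuous maps. -/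
theorem continuous_symm_of_biorthogonal (h : ℂ ≃+* ℂ) (T : E ≃+ Y)
    (hT : ∀ (c : ℂ) e, T (c • e) = h c • T e) (e : ℕ → E) (ℓ : ℕ → StrongDual ℂ E)
    (h1 : ∀ n, ℓ n (e n) = 1) (h2 : ∀ m n, m ≠ n → ℓ m (e n) = 0)
    (hc : ∀ n, Continuous fun y => h (ℓ n (T.symm y))) : Continuous h.symm := by
  -- Otherwise pick small `c n` with `‖h⁻¹ (c n)‖ > n ‖ℓ n‖`. The series `∑ c n • T (e n)` converges
  -- to some `y` with `ℓ m (T⁻¹ y) = h⁻¹ (c m)`, against the bound `‖ℓ m‖ ‖T⁻¹ y‖`. The `+ 1` keeps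
  -- the denominator positive.
  obtain ⟨n, hn⟩ : ∃ n : ℕ, ∀ c, ‖c‖ ≤ (1 / 2 : ℝ) ^ n / (‖T (e n)‖ + 1) →
      ‖h.symm c‖ ≤ n * ‖ℓ n‖ := by
    by_contra! H
    choose c hc1 hc2 using H
    have hsum : Summable fun n => c n • T (e n) := by
      refine Summable.of_norm_bounded (g := fun n : ℕ => (1 / 2 : ℝ) ^ n)
        summable_geometric_two fun n => ?_
      rw [norm_smul]
      have h3 := (le_div_iff₀ (by positivity : 0 < ‖T (e n)‖ + 1)).1 (hc1 n)
      nlinarith [norm_nonneg (c n)]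
    obtain ⟨y, hy⟩ := hsum
    have hval : ∀ m, ℓ m (T.symm y) = h.symm (c m) := by
      intro m
      let G : Y →+ ℂ := (h : ℂ →+ ℂ).comp ((ℓ m : E →+ ℂ).comp (T.symm : Y →+ E))
      have hG := hy.map G (hc m)
      have hterm : ∀ n, G (c n • T (e n)) = c n * h (ℓ m (e n)) := by
        intro n
        have h4 : T.symm (c n • T (e n)) = h.symm (c n) • e n := by
          rw [T.symm_apply_eq, hT, h.apply_symm_apply]
        change h (ℓ m (T.symm (c n • T (e n)))) = _
        rw [h4, map_smul, smul_eq_mul, map_mul, h.apply_symm_apply]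
      have h5 : HasSum (G ∘ fun n => c n • T (e n)) (c m) := by
        have := hasSum_single (f := G ∘ fun n => c n • T (e n)) m fun n hn => by
          rw [Function.comp, hterm, h2 m n hn.symm, map_zero, mul_zero]
        simpa only [Function.comp, hterm, h1, map_one, mul_one] using this
      rw [RingEquiv.eq_symm_apply]
      exact hG.unique h5
    obtain ⟨m, hm⟩ := exists_nat_gt ‖T.symm y‖
    have h6 := hc2 m
    rw [← hval m] at h6
    have h7 := (ℓ m).le_opNorm (T.symm y)
    nlinarith [norm_nonneg (ℓ m)]
  exact AddMonoidHom.continuous_of_bounded_near_zero (h.symm : ℂ →+ ℂ)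
    (δ := (1 / 2 : ℝ) ^ n / (‖T (e n)‖ + 1)) (by positivity) hn

theorem RingEquiv.eq_id_or_conj_of_continuous_symm (h : ℂ ≃+* ℂ) (hc : Continuous h.symm) :
    (∀ c, h c = c) ∨ (∀ c, h c = starRingEnd ℂ c) := by
  rcases Complex.ringHom_eq_id_or_conj_of_continuous (f := (h.symm : ℂ →+* ℂ)) hc with h1 | h1
  · left
    intro c
    have := congrArg (fun f : ℂ →+* ℂ => f c) h1
    exact ((h.symm_apply_eq).1 this).symm
  · right
    intro c
    have := congrArg (fun f : ℂ →+* ℂ => f (starRingEnd ℂ c)) h1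
    simp only [RingHom.coe_coe, Complex.conj_conj] at this
    exact ((h.symm_apply_eq).1 this).symm

variable [CompleteSpace E]

/-- Working over `ℝ` treats the linear and conjugate-linear cases together. The separating functions
identify limits in the graph of `T⁻¹`; continuity of `T⁻¹` then closes the graph of `T`. -/
theorem continuous_of_real_homogeneous (T : E ≃+ Y) (hT : ∀ (r : ℝ) e, T (r • e) = r • T e)
    {ι : Type*} (L : ι → E → ℂ) (hLc : ∀ i, Continuous (L i))
    (hL : ∀ a b, (∀ i, L i a = L i b) → a = b)
    (hc : ∀ i, Continuous fun y => L i (T.symm y)) : Continuous T ∧ Continuous T.symm := by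
  let T' : E ≃ₗ[ℝ] Y := { T with map_smul' := hT }
  have h1 : Continuous T'.symm := by
    refine LinearMap.continuous_of_seq_closed_graph (T'.symm : Y →ₗ[ℝ] E) fun u y x hu hx => ?_
    refine hL _ _ fun i => ?_
    exact tendsto_nhds_unique (((hLc i).tendsto x).comp hx) (((hc i).tendsto y).comp hu)
  have h2 : Continuous T' := by
    refine LinearMap.continuous_of_seq_closed_graph (T' : E →ₗ[ℝ] Y) fun u x y hu hy => ?_
    refine T'.symm_apply_eq.1 ?_
    refine tendsto_nhds_unique ((h1.tendsto y).comp hy) ?_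
    convert hu using 1
    funext n
    exact T'.symm_apply_apply (u n)
  exact ⟨h2, h1⟩

/-- A semilinear bijection of infinite dimensional Banach spaces which transports a separating
family of functionals to continuous maps is bounded, and linear or conjugate-linear. -/
theorem exists_continuousLinearEquiv_of_semilinear (h : ℂ ≃+* ℂ) (T : E ≃+ Y)
    (hT : ∀ (c : ℂ) e, T (c • e) = h c • T e) {ι : Type*} (L : ι → StrongDual ℂ E)
    (hL : ∀ e, (∀ i, L i e = 0) → e = 0)
    (hc : ∀ i, Continuous fun y => h (L i (T.symm y))) (e : ℕ → E) (i : ℕ → ι)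
    (h1 : ∀ n, L (i n) (e n) = 1) (h2 : ∀ m n, m ≠ n → L (i m) (e n) = 0) :
    (∃ S : E ≃L[ℂ] Y, ∀ e, S e = T e) ∨ (∃ S : E ≃SL[starRingEnd ℂ] Y, ∀ e, S e = T e) := by
  have hcont := continuous_symm_of_biorthogonal h T hT e (fun n => L (i n)) h1 h2 fun n => hc _
  have hsep : ∀ a b, (∀ i, L i a = L i b) → a = b := fun a b hab =>
    sub_eq_zero.1 (hL _ fun i => by rw [map_sub, hab, sub_self])
  rcases h.eq_id_or_conj_of_continuous_symm hcont with hid | hconj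
  · left
    simp only [hid] at hT hc
    obtain ⟨c1, c2⟩ := continuous_of_real_homogeneous T
      (fun r e => by simpa using hT r e) (fun i e => L i e) (fun i => (L i).continuous) hsep hc
    exact ⟨{ toFun := T, invFun := T.symm, map_add' := map_add T, map_smul' := hT,
             left_inv := T.left_inv, right_inv := T.right_inv,
             continuous_toFun := c1, continuous_invFun := c2 }, fun _ => rfl⟩
  · right
    simp only [hconj] at hT hc
    obtain ⟨c1, c2⟩ := continuous_of_real_homogeneous T
      (fun r e => by simpa using hT r e) (fun i e => L i e) (fun i => (L i).continuous) hsep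
      (fun i => by simpa [Function.comp_def] using Complex.continuous_conj.comp (hc i))
    exact ⟨{ toFun := T, invFun := T.symm, map_add' := map_add T, map_smul' := hT,
             left_inv := T.left_inv, right_inv := T.right_inv,
             continuous_toFun := c1, continuous_invFun := c2 }, fun _ => rfl⟩

end Continuity

/-! ### Matrices of semilinear bijections -/

section FiniteDimensional

variable {E Y : Type*} [AddCommGroup E] [Module ℂ E] [AddCommGroup Y] [Module ℂ Y]

/-- The image of a basis under a semilinear bijection. -/
theorem Module.Basis.exists_map_semilinear {n : ℕ} (h : ℂ ≃+* ℂ) (T : E ≃+ Y)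
    (hT : ∀ (c : ℂ) e, T (c • e) = h c • T e) (e : Module.Basis (Fin n) ℂ E) :
    ∃ b : Module.Basis (Fin n) ℂ Y,
      (∀ v i, b.repr (T v) i = h (e.repr v i)) ∧ ∀ i, b i = T (e i) := by
  have hsymm : ∀ (c : ℂ) y, T.symm (c • y) = h.symm c • T.symm y := fun c y => by
    rw [T.symm_apply_eq, hT, h.apply_symm_apply, T.apply_symm_apply]
  let B : Y ≃ₗ[ℂ] (Fin n → ℂ) :=
    -- `T⁻¹` is semilinear over `h⁻¹`; applying `h` to the coordinates restores linearity.
    { toFun := fun y i => h (e.repr (T.symm y) i)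
      invFun := fun v => T (e.equivFun.symm fun i => h.symm (v i))
      map_add' := fun x y => by ext i; simp
      map_smul' := fun c y => by ext i; simp [hsymm]
      left_inv := fun y => by
        simp only [RingEquiv.symm_apply_apply]
        rw [← T.eq_symm_apply, LinearEquiv.symm_apply_eq]
        rfl
      right_inv := fun v => by
        ext i
        simp only [AddEquiv.symm_apply_apply]
        rw [← Module.Basis.equivFun_apply, LinearEquiv.apply_symm_apply, RingEquiv.apply_symm_apply] }
  have hrepr : ∀ v i, (Module.Basis.ofEquivFun B).repr (T v) i = h (e.repr v i) := fun v i => by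
    change h (e.repr (T.symm (T v)) i) = _
    rw [T.symm_apply_apply]
  refine ⟨Module.Basis.ofEquivFun B, hrepr, fun j => ?_⟩
  apply (Module.Basis.ofEquivFun B).repr.injective
  ext i
  rw [hrepr, Module.Basis.repr_self, Module.Basis.repr_self, Finsupp.single_apply]
  split_ifs <;> simp

/-- In the basis `T (e i)` the matrix of `B` is that of `A` with `h` applied entrywise; `M` is the
change of basis to `c`, so it does not depend on `A` and `B`. -/
theorem exists_matrix_of_semilinear {n : ℕ} (h : ℂ ≃+* ℂ) (T : E ≃+ Y)
    (hT : ∀ (c : ℂ) e, T (c • e) = h c • T e) (e : Module.Basis (Fin n) ℂ E)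
    (c : Module.Basis (Fin n) ℂ Y) : ∃ M : Matrix (Fin n) (Fin n) ℂ, IsUnit M ∧
      ∀ (A : E → E) (B : Y →ₗ[ℂ] Y), (∀ v, T (A v) = B (T v)) →
        LinearMap.toMatrix c c B =
          M * (Matrix.of fun i j => e.repr (A (e j)) i).map h * M⁻¹ := by
  obtain ⟨b, hb, hb'⟩ := e.exists_map_semilinear h T hT
  have h1 : c.toMatrix b * b.toMatrix c = 1 := c.toMatrix_mul_toMatrix_flip b
  refine ⟨c.toMatrix b, IsUnit.of_mul_eq_one _ h1, fun A B hAB => ?_⟩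
  rw [Matrix.inv_eq_right_inv h1, ← basis_toMatrix_mul_linearMap_toMatrix_mul_basis_toMatrix c b c b]
  congr 2
  ext i j
  rw [LinearMap.toMatrix_apply, hb', ← hAB, hb]
  rfl

end FiniteDimensional

/-! ### Jordan maps of standard operator algebras -/

section Jordan

variable {X Y : Type*} [NormedAddCommGroup X] [NormedSpace ℂ X]
  [NormedAddCommGroup Y] [NormedSpace ℂ Y]
  {𝒜 : NonUnitalSubalgebra ℂ (X →L[ℂ] X)} {ℬ : NonUnitalSubalgebra ℂ (Y →L[ℂ] Y)}
  (h𝒜 : IsStandardOperatorAlgebra 𝒜) (hℬ : IsStandardOperatorAlgebra ℬ)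

include h𝒜 hℬ

/-- The left ideal `{f₀ ⊗ x}` is a copy of `X` on which the algebra acts as on `X`. -/
theorem exists_semilinear_of_hom {x₀ : X} {f₀ : StrongDual ℂ X} (h₀ : f₀ x₀ = 1) {φ : 𝒜 → ℬ}
    (hφ : Function.Bijective φ) (hadd : ∀ A B, φ (A + B) = φ A + φ B)
    (hmul : ∀ A B, φ (A * B) = φ A * φ B) :
    ∃ (h : ℂ ≃+* ℂ) (T : X ≃+ Y), (∀ (c : ℂ) x, T (c • x) = h c • T x) ∧
      ∀ (A : 𝒜) x, T ((A : X →L[ℂ] X) x) = (φ A : Y →L[ℂ] Y) (T x) := by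
  have hx₀ : x₀ ≠ 0 := by rintro rfl; simp at h₀
  let ψ : 𝒜 ≃+* ℬ :=
    { Equiv.ofBijective φ hφ with map_add' := hadd, map_mul' := hmul }
  let ι : X →+ 𝒜 := AddMonoidHom.mk' (h𝒜.rankOne f₀) fun x y =>
    NonUnitalSubalgebra.operator_ext fun v => smul_add (f₀ v) x y
  refine hℬ.exists_semilinear_of_ringEquiv ψ ι ?_ (fun A x => (A : X →L[ℂ] X) x) x₀ hx₀ ?_ ?_ ?_
  · intro x y hxy
    have := congrArg (fun A : 𝒜 => (A : X →L[ℂ] X) x₀) hxy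
    simpa [ι, h₀] using this
  · exact fun A x => h𝒜.mul_rankOne A f₀ x
  · intro c x
    change h𝒜.rankOne f₀ x * h𝒜.rankOne f₀ (c • x₀) = h𝒜.rankOne f₀ (c • x)
    simp [h𝒜.mul_rankOne, h₀]
  · intro A
    refine ⟨f₀ ((A : X →L[ℂ] X) x₀), ?_⟩
    change h𝒜.rankOne f₀ x₀ * A * h𝒜.rankOne f₀ x₀ = h𝒜.rankOne f₀ _
    rw [mul_assoc, h𝒜.mul_rankOne, h𝒜.mul_rankOne, h𝒜.rankOne_apply]

/-- In the opposite algebra the left ideal `{f ⊗ x₀}` is a copy of `X'`, with the action by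
adjoints. -/
theorem exists_semilinear_of_antihom {x₀ : X} {f₀ : StrongDual ℂ X} (h₀ : f₀ x₀ = 1) {φ : 𝒜 → ℬ}
    (hφ : Function.Bijective φ) (hadd : ∀ A B, φ (A + B) = φ A + φ B)
    (hmul : ∀ A B, φ (A * B) = φ B * φ A) :
    ∃ (h : ℂ ≃+* ℂ) (T : StrongDual ℂ X ≃+ Y), (∀ (c : ℂ) f, T (c • f) = h c • T f) ∧
      ∀ (A : 𝒜) f, T (banachAdjoint (A : X →L[ℂ] X) f) = (φ A : Y →L[ℂ] Y) (T f) := by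
  have hx₀ : x₀ ≠ 0 := by rintro rfl; simp at h₀
  have hf₀ : f₀ ≠ 0 := by rintro rfl; simp at h₀
  let ψ : 𝒜ᵐᵒᵖ ≃+* ℬ :=
    { MulOpposite.opEquiv.symm.trans (Equiv.ofBijective φ hφ) with
      map_add' := fun A B => hadd A.unop B.unop
      map_mul' := fun A B => hmul B.unop A.unop }
  let ι : StrongDual ℂ X →+ 𝒜ᵐᵒᵖ := AddMonoidHom.mk'
    (fun f => MulOpposite.op (h𝒜.rankOne f x₀)) fun f g => by
      rw [← MulOpposite.op_add]
      exact congrArg _ (NonUnitalSubalgebra.operator_ext fun v => add_smul (f v) (g v) x₀)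
  suffices H : ∃ (h : ℂ ≃+* ℂ) (T : StrongDual ℂ X ≃+ Y), (∀ (c : ℂ) f, T (c • f) = h c • T f) ∧
      ∀ (A : 𝒜ᵐᵒᵖ) f, T (banachAdjoint (A.unop : X →L[ℂ] X) f) = (ψ A : Y →L[ℂ] Y) (T f) by
    obtain ⟨h, T, hT, hT'⟩ := H
    exact ⟨h, T, hT, fun A f => hT' (MulOpposite.op A) f⟩
  refine hℬ.exists_semilinear_of_ringEquiv ψ ι ?_
    (fun A f => banachAdjoint (A.unop : X →L[ℂ] X) f) f₀ hf₀ ?_ ?_ ?_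
  · intro f g hfg
    ext v
    have := congrArg (fun A : 𝒜 => (A : X →L[ℂ] X) v) (MulOpposite.op_injective hfg)
    exact smul_left_injective ℂ hx₀ this
  · intro A f
    change A * MulOpposite.op _ = MulOpposite.op _
    rw [← MulOpposite.op_unop A, ← MulOpposite.op_mul, h𝒜.rankOne_mul]
    rfl
  · intro c f
    change MulOpposite.op (h𝒜.rankOne f x₀) * MulOpposite.op (h𝒜.rankOne (c • f₀) x₀) =
      MulOpposite.op (h𝒜.rankOne (c • f) x₀)
    rw [← MulOpposite.op_mul, h𝒜.mul_rankOne, ← h𝒜.rankOne_smul, h𝒜.rankOne_apply, h₀,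
      one_smul, h𝒜.rankOne_smul]
  · intro A
    refine ⟨f₀ ((A.unop : X →L[ℂ] X) x₀), ?_⟩
    change MulOpposite.op (h𝒜.rankOne f₀ x₀) * A * MulOpposite.op (h𝒜.rankOne f₀ x₀) =
      MulOpposite.op (h𝒜.rankOne _ x₀)
    rw [← MulOpposite.op_unop A, ← MulOpposite.op_mul, ← MulOpposite.op_mul, h𝒜.mul_rankOne,
      h𝒜.mul_rankOne, h𝒜.rankOne_apply, h𝒜.rankOne_smul]
    rfl

omit hℬ in
/-- A bijective Jordan multiplicative map between standard operator algebras is additive. -/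
theorem IsStandardOperatorAlgebra.jordan_map_add (hX : 1 < Module.rank ℂ X) {φ : 𝒜 → ℬ}
    (hφ : Function.Bijective φ)
    (hJ : ∀ A B : 𝒜, φ (jordanMul A B) = jordanMul (φ A) (φ B)) (A B : 𝒜) :
    φ (A + B) = φ A + φ B := by
  have : Nontrivial X := rank_pos_iff_nontrivial.1 (zero_lt_one.trans hX)
  obtain ⟨x₀, hx₀⟩ := exists_ne (0 : X)
  obtain ⟨f₀, h₀⟩ := SeparatingDual.exists_eq_one (R := ℂ) hx₀
  exact _root_.jordan_map_add hφ hJ (h𝒜.isPeirceFaithful_rankOne h₀ hX) A B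

/-- A bijective Jordan multiplicative map between standard operator algebras is implemented by a
semilinear bijection defined on the space or on its dual. -/
theorem exists_semilinear_of_jordan (hX : 1 < Module.rank ℂ X) {φ : 𝒜 → ℬ}
    (hφ : Function.Bijective φ)
    (hJ : ∀ A B : 𝒜, φ (jordanMul A B) = jordanMul (φ A) (φ B)) :
    (∃ (h : ℂ ≃+* ℂ) (T : X ≃+ Y), (∀ (c : ℂ) x, T (c • x) = h c • T x) ∧
      ∀ (A : 𝒜) x, T ((A : X →L[ℂ] X) x) = (φ A : Y →L[ℂ] Y) (T x)) ∨
    (∃ (h : ℂ ≃+* ℂ) (T : StrongDual ℂ X ≃+ Y), (∀ (c : ℂ) f, T (c • f) = h c • T f) ∧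
      ∀ (A : 𝒜) f, T (banachAdjoint (A : X →L[ℂ] X) f) = (φ A : Y →L[ℂ] Y) (T f)) := by
  have hadd := h𝒜.jordan_map_add hX hφ hJ
  have : Nontrivial X := rank_pos_iff_nontrivial.1 (zero_lt_one.trans hX)
  obtain ⟨x₀, hx₀⟩ := exists_ne (0 : X)
  obtain ⟨f₀, h₀⟩ := SeparatingDual.exists_eq_one (R := ℂ) hx₀
  rcases jordan_hom_or_antihom hℬ.isPrimeElementwise hφ.2 hadd hJ with hmul | hmul
  · exact Or.inl (exists_semilinear_of_hom h𝒜 hℬ h₀ hφ hadd hmul)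
  · exact Or.inr (exists_semilinear_of_antihom h𝒜 hℬ h₀ hφ hadd hmul)

omit hℬ

variable [CompleteSpace X] [CompleteSpace Y]

theorem exists_continuousLinearEquiv_of_hom (hX : ¬ FiniteDimensional ℂ X) {φ : 𝒜 → ℬ}
    (h : ℂ ≃+* ℂ) (T : X ≃+ Y) (hT : ∀ (c : ℂ) x, T (c • x) = h c • T x)
    (hTφ : ∀ (A : 𝒜) x, T ((A : X →L[ℂ] X) x) = (φ A : Y →L[ℂ] Y) (T x)) :
    (∃ S : X ≃L[ℂ] Y, ∀ e, S e = T e) ∨ (∃ S : X ≃SL[starRingEnd ℂ] Y, ∀ e, S e = T e) := by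
  obtain ⟨x, f, h1, h2⟩ := exists_biorthogonal_sequence hX
  have hx : T (x 0) ≠ 0 := fun h0 => by
    have := h1 0
    rw [T.map_eq_zero_iff.1 h0] at this
    simp at this
  obtain ⟨g, hg⟩ := SeparatingDual.exists_eq_one (R := ℂ) hx
  refine exists_continuousLinearEquiv_of_semilinear h T hT (fun f : StrongDual ℂ X => f)
    (fun e he => SeparatingDual.eq_zero_of_forall_dual_eq_zero (R := ℂ) he) (fun f => ?_) x f h1 h2
  -- `φ (f ⊗ x 0)` sends `y` to `h (f (T⁻¹ y)) • T (x 0)`, and `g` normalizes `T (x 0)` to `1`;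
  -- boundedness of `φ (f ⊗ x 0)` supplies the continuity.
  have : (fun y => h (f (T.symm y))) = fun y => g ((φ (h𝒜.rankOne f (x 0)) : Y →L[ℂ] Y) y) := by
    ext y
    have := hTφ (h𝒜.rankOne f (x 0)) (T.symm y)
    rw [T.apply_symm_apply] at this
    rw [← this, h𝒜.rankOne_apply, hT, map_smul, hg, smul_eq_mul, mul_one]
  rw [this]
  exact g.continuous.comp (ContinuousLinearMap.continuous _)

omit [CompleteSpace X] in
-- Evaluations at points of `X` already separate `X'`, so no reflexivity is needed; the biorthogonal
-- vectors and functionals exchange roles.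
theorem exists_continuousLinearEquiv_of_antihom (hX : ¬ FiniteDimensional ℂ X) {φ : 𝒜 → ℬ}
    (h : ℂ ≃+* ℂ) (T : StrongDual ℂ X ≃+ Y) (hT : ∀ (c : ℂ) f, T (c • f) = h c • T f)
    (hTφ : ∀ (A : 𝒜) f, T (banachAdjoint (A : X →L[ℂ] X) f) = (φ A : Y →L[ℂ] Y) (T f)) :
    (∃ S : StrongDual ℂ X ≃L[ℂ] Y, ∀ e, S e = T e) ∨
      (∃ S : StrongDual ℂ X ≃SL[starRingEnd ℂ] Y, ∀ e, S e = T e) := by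
  obtain ⟨x, f, h1, h2⟩ := exists_biorthogonal_sequence hX
  have hf : T (f 0) ≠ 0 := fun h0 => by
    have := h1 0
    rw [T.map_eq_zero_iff.1 h0] at this
    simp at this
  obtain ⟨g, hg⟩ := SeparatingDual.exists_eq_one (R := ℂ) hf
  refine exists_continuousLinearEquiv_of_semilinear h T hT
    (fun x : X => NormedSpace.inclusionInDoubleDual ℂ X x)
    (fun e he => ContinuousLinearMap.ext he) (fun v => ?_) f x h1 fun m n hmn => h2 n m hmn.symm
  have : (fun y => h (NormedSpace.inclusionInDoubleDual ℂ X v (T.symm y))) =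
      fun y => g ((φ (h𝒜.rankOne (f 0) v) : Y →L[ℂ] Y) y) := by
    ext y
    have h3 := hTφ (h𝒜.rankOne (f 0) v) (T.symm y)
    have h4 : banachAdjoint (h𝒜.rankOne (f 0) v : X →L[ℂ] X) (T.symm y) =
        (T.symm y v) • f 0 := by
      ext w
      rw [banachAdjoint_apply, h𝒜.rankOne_apply, map_smul, smul_eq_mul, mul_comm]
      rfl
    rw [T.apply_symm_apply, h4, hT] at h3
    rw [← h3, map_smul, hg, smul_eq_mul, mul_one]
    rfl
  rw [this]
  exact g.continuous.comp (ContinuousLinearMap.continuous _)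

omit [CompleteSpace X] in
theorem IsStandardOperatorAlgebra.eq_top [FiniteDimensional ℂ X] : 𝒜 = ⊤ :=
  SetLike.ext fun _ => ⟨fun _ => NonUnitalAlgebra.mem_top, fun _ => h𝒜 _ inferInstance⟩

end Jordan

/-! ### The main theorem -/

theorem theorem1 {X : Type*} {Y : Type*}
    [NormedAddCommGroup X] [NormedSpace ℂ X] [CompleteSpace X]
    [NormedAddCommGroup Y] [NormedSpace ℂ Y] [CompleteSpace Y]
    (hX : 1 < Module.rank ℂ X)
    (𝒜 : NonUnitalSubalgebra ℂ (X →L[ℂ] X)) (ℬ : NonUnitalSubalgebra ℂ (Y →L[ℂ] Y))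
    (h𝒜 : IsStandardOperatorAlgebra 𝒜) (hℬ : IsStandardOperatorAlgebra ℬ)
    (φ : 𝒜 → ℬ) (hφ : Function.Bijective φ)
    (hJ : ∀ A B : 𝒜, φ ((1 / 2 : ℂ) • (A * B + B * A)) =
      (1 / 2 : ℂ) • (φ A * φ B + φ B * φ A)) :
    -- `φ` is additive
    (∀ A B : 𝒜, φ (A + B) = φ A + φ B) ∧
    -- the infinite dimensional case
    (¬ FiniteDimensional ℂ X →
      (∃ T : X ≃L[ℂ] Y, ∀ A : 𝒜, (φ A : Y →L[ℂ] Y) =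
        (T : X →L[ℂ] Y).comp ((A : X →L[ℂ] X).comp (T.symm : Y →L[ℂ] X))) ∨
      (∃ T : X ≃SL[starRingEnd ℂ] Y, ∀ A : 𝒜, (φ A : Y →L[ℂ] Y) =
        (T : X →SL[starRingEnd ℂ] Y).comp
          ((A : X →L[ℂ] X).comp (T.symm : Y →SL[starRingEnd ℂ] X))) ∨
      (∃ T : StrongDual ℂ X ≃L[ℂ] Y, ∀ A : 𝒜, (φ A : Y →L[ℂ] Y) =
        (T : StrongDual ℂ X →L[ℂ] Y).comp
          ((banachAdjoint (A : X →L[ℂ] X)).comp (T.symm : Y →L[ℂ] StrongDual ℂ X))) ∨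
      (∃ T : StrongDual ℂ X ≃SL[starRingEnd ℂ] Y, ∀ A : 𝒜, (φ A : Y →L[ℂ] Y) =
        (T : StrongDual ℂ X →SL[starRingEnd ℂ] Y).comp
          ((banachAdjoint (A : X →L[ℂ] X)).comp
            (T.symm : Y →SL[starRingEnd ℂ] StrongDual ℂ X)))) ∧
    -- the finite dimensional case: both algebras are full operator algebras over spaces of the
    -- same dimension, and `φ` is described on matrices with respect to any choice of bases
    (FiniteDimensional ℂ X →
      FiniteDimensional ℂ Y ∧ Module.finrank ℂ X = Module.finrank ℂ Y ∧ 𝒜 = ⊤ ∧ ℬ = ⊤ ∧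
      ∀ (n : ℕ) (b : Module.Basis (Fin n) ℂ X) (c : Module.Basis (Fin n) ℂ Y),
        (∃ (h : ℂ ≃+* ℂ) (T : Matrix (Fin n) (Fin n) ℂ), IsUnit T ∧ ∀ A : 𝒜,
          LinearMap.toMatrix c c ((φ A : Y →L[ℂ] Y) : Y →ₗ[ℂ] Y) =
            T * (LinearMap.toMatrix b b ((A : X →L[ℂ] X) : X →ₗ[ℂ] X)).map h * T⁻¹) ∨
        (∃ (h : ℂ ≃+* ℂ) (T : Matrix (Fin n) (Fin n) ℂ), IsUnit T ∧ ∀ A : 𝒜,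
          LinearMap.toMatrix c c ((φ A : Y →L[ℂ] Y) : Y →ₗ[ℂ] Y) =
            T * ((LinearMap.toMatrix b b ((A : X →L[ℂ] X) : X →ₗ[ℂ] X)).map h)ᵀ * T⁻¹)) := by
  have hJ' : ∀ A B : 𝒜, φ (jordanMul A B) = jordanMul (φ A) (φ B) := hJ
  refine ⟨h𝒜.jordan_map_add hX hφ hJ', fun hinf => ?_, fun hfin => ?_⟩
  · rcases exists_semilinear_of_jordan h𝒜 hℬ hX hφ hJ' with ⟨h, T, hT, hTφ⟩ | ⟨h, T, hT, hTφ⟩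
    · rcases exists_continuousLinearEquiv_of_hom h𝒜 hinf h T hT hTφ with ⟨S, hS⟩ | ⟨S, hS⟩
      · refine Or.inl ⟨S, fun A => ContinuousLinearMap.ext fun y => ?_⟩
        obtain ⟨x, rfl⟩ := S.surjective y
        change (φ A : Y →L[ℂ] Y) (S x) = S ((A : X →L[ℂ] X) (S.symm (S x)))
        rw [S.symm_apply_apply, hS, hS, hTφ]
      · refine Or.inr (Or.inl ⟨S, fun A => ContinuousLinearMap.ext fun y => ?_⟩)
        obtain ⟨x, rfl⟩ := S.surjective y
        change (φ A : Y →L[ℂ] Y) (S x) = S ((A : X →L[ℂ] X) (S.symm (S x)))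
        rw [S.symm_apply_apply, hS, hS, hTφ]
    · rcases exists_continuousLinearEquiv_of_antihom h𝒜 hinf h T hT hTφ with ⟨S, hS⟩ | ⟨S, hS⟩
      · refine Or.inr (Or.inr (Or.inl ⟨S, fun A => ContinuousLinearMap.ext fun y => ?_⟩))
        obtain ⟨x, rfl⟩ := S.surjective y
        change (φ A : Y →L[ℂ] Y) (S x) = S (banachAdjoint (A : X →L[ℂ] X) (S.symm (S x)))
        rw [S.symm_apply_apply, hS, hS, hTφ]
      · refine Or.inr (Or.inr (Or.inr ⟨S, fun A => ContinuousLinearMap.ext fun y => ?_⟩))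
        obtain ⟨x, rfl⟩ := S.surjective y
        change (φ A : Y →L[ℂ] Y) (S x) = S (banachAdjoint (A : X →L[ℂ] X) (S.symm (S x)))
        rw [S.symm_apply_apply, hS, hS, hTφ]
  · let dual : ∀ {n : ℕ}, Module.Basis (Fin n) ℂ X → Module.Basis (Fin n) ℂ (StrongDual ℂ X) :=
      fun b => b.dualBasis.map LinearMap.toContinuousLinearMap
    have hdim : FiniteDimensional ℂ Y ∧ Module.finrank ℂ X = Module.finrank ℂ Y := by
      obtain ⟨c⟩ : Nonempty (Module.Basis (Fin (Module.finrank ℂ X)) ℂ Y) := by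
        -- In either case `T` carries a basis indexed by `Fin (finrank X)`, of `X` or of `X'`, to a
        -- basis of `Y`.
        have b := Module.finBasis ℂ X
        rcases exists_semilinear_of_jordan h𝒜 hℬ hX hφ hJ' with ⟨h, T, hT, -⟩ | ⟨h, T, hT, -⟩
        · exact ⟨(b.exists_map_semilinear h T hT).choose⟩
        · exact ⟨((dual b).exists_map_semilinear h T hT).choose⟩
      exact ⟨Module.Finite.of_basis c, by rw [Module.finrank_eq_card_basis c, Fintype.card_fin]⟩
    obtain ⟨hY, hrank⟩ := hdim
    refine ⟨hY, hrank, h𝒜.eq_top, hℬ.eq_top, fun n b c => ?_⟩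
    rcases exists_semilinear_of_jordan h𝒜 hℬ hX hφ hJ' with ⟨h, T, hT, hTφ⟩ | ⟨h, T, hT, hTφ⟩
    · obtain ⟨M, hM, hM'⟩ := exists_matrix_of_semilinear h T hT b c
      refine Or.inl ⟨h, M, hM, fun A => ?_⟩
      rw [hM' _ _ (hTφ A)]
      congr 3
      ext i j
      rw [LinearMap.toMatrix_apply]
      rfl
    · obtain ⟨M, hM, hM'⟩ := exists_matrix_of_semilinear h T hT (dual b) c
      refine Or.inr ⟨h, M, hM, fun A => ?_⟩
      rw [hM' _ _ (hTφ A), ← Matrix.transpose_map]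
      congr 3
      ext i j
      rw [Matrix.transpose_apply, LinearMap.toMatrix_apply, Matrix.of_apply, Module.Basis.map_repr,
        Module.Basis.map_apply]
      simp only [LinearEquiv.trans_apply, Module.Basis.dualBasis_repr]
      -- The `(i, j)` entry of the adjoint in the dual basis is the `j`-th coordinate of `A (b i)`,
      -- that is, the `(j, i)` entry of `A`.
      change b.dualBasis j ((A : X →L[ℂ] X) (b i)) = _
      rw [Module.Basis.dualBasis_apply]
      rfl
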